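/- **Setting.** Let $E=\{1,\dots,n\}$, and for $d\ge 0$ let $E_d$ be the set of $d$-subsets of $E$. Let $\mathrm{Harm}_d(n)$ be the space of functions $f:E_d\to\mathbb R$ with $\sum_{Z\in E_d,\,Z\supseteq Y}f(Z)=0$ for all $Y\in E_{d-1}$ (no condition if $d=0$), and put $\widetilde f(X)=\sum_{Z\in E_d,\,Z\subseteq X}f(Z)$ for $X\subseteq E$. For a linear code $C\subseteq\mathbb F_q^n$ and $m\ge 1$ let $A_C^{[m]}(X)$ be the number of $m$-tuples of codewords whose supports have union $X$, and $$W^{[m]}_{C,f}=\sum_{X\subseteq E}\widetilde f(X)A^{[m]}_C(X)\,x^{n-|X|}y^{|X|},\qquad Z^{[m]}_{C,f}=\sum_{d\le |X|\le n-d}\widetilde f(X)A^{[m]}_C(X)\,x^{n-|X|-d}y^{|X|-d}.$$ A self-dual code is of Type I, II, III, IV if $q=2,2,3,4$ and all its weights are divisible by $2,4,3,2$ respectively (Euclidean self-duality for Types I–III, Hermitian for Type IV). Put $N=2,8,4,2$ respectively, $\omega_N=e^{2\pi i/N}$, $$S_{m,q}=\frac1{\sqrt{q^m}}\begin{pmatrix}1&q^m-1\\1&-1\end{pmatrix},\qquad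 G^X_m=\langle S_{m,q},\ \omega_N I\rangle\le GL_2(\mathbb C),$$ and for a character $\chi$ of $G^X_m$ let $I_\chi=\{P\in\mathbb C[x,y]: P(g(x,y)^T)=\chi(g)P\ \ \forall g\in G^X_m\}$. For integers $d,e\ge 0$ let $\chi_{d,e}$ be the character of $G_m^X$ with $\chi_{d,e}(S_{m,q})=(-1)^{-d}$ and $\chi_{d,e}(\omega_N I)=\omega_N^{-e}$. Put $$u=x+(\sqrt{q^m}-1)y,\qquad v=x-(\sqrt{q^m}+1)y,\qquad P_1=u^N,\quad P_2=v^N,\quad \mathfrak R=\mathbb C[P_1,P_2].$$ **Theorem.** Let $m\ge 1$, $d\ge 0$ and $X\in\{\mathrm I,\mathrm{II},\mathrm{III},\mathrm{IV}\}$. (0) For every $e\ge0$ the character $\chi_{d,e}$ exists and is unique, and $P_1,P_2$ are algebraically independent. (A) For every Type $X$ code $C$ of length $n$ and every $f\in \mathrm{Harm}_d(n)$ one has $W^{[m]}_{C,f}=(xy)^dZ^{[m]}_{C,f}$ and $Z^{[m]}_{C,f}\in I_{\chi_{d,2d}}$. Moreover $Z^{[m]}_{C,f}\in I_{\chi_{d,d}}$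 if and only if $N\mid d$ or $Z^{[m]}_{C,f}=0$. (B) $I_{\chi_{d,d}}=\bigoplus_i Q_i\mathfrak R$, each summand free of rank one, with the following generators $Q_i$: - Type I and Type IV: $1$ if $d\equiv0\pmod 2$; $\ v$ if $d\equiv1\pmod 2$. - Type II, by $d$ mod $8$: - $0$: $1,\ u^6v^2,\ u^4v^4,\ u^2v^6$; - $1$: $u^6v,\ u^4v^3,\ u^2v^5,\ v^7$; - $2$: $u^6,\ u^4v^2,\ u^2v^4,\ v^6$; - $3$: $u^4v,\ u^2v^3,\ v^5,\ u^6v^7$; - $4$: $u^4,\ u^2v^2,\ v^4,\ u^6v^6$; - $5$: $u^2v,\ v^3,\ u^6v^5,\ u^4v^7$; - $6$: $u^2,\ v^2,\ u^6v^4,\ u^4v^6$; - $7$: $v,\ u^6v^3,\ u^4v^5,\ u^2v^7$. - Type III, by $d$ mod $4$: - $0$: $1,\ u^2v^2$; - $1$: $u^2v,\ v^3$; - $2$: $u^2,\ v^2$; - $3$: $v,\ u^2v^3$. (C) $I_{\chi_{d,2d}}=\bigoplus_i Q_i\mathfrak R$, each summand free of rank one, with the following generators $Q_i$: - Type I and Type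 IV: $1$ if $d\equiv0\pmod 2$; $\ uv$ if $d\equiv1\pmod 2$. - Type II, by $d$ mod $4$: - $0$: $1,\ u^6v^2,\ u^4v^4,\ u^2v^6$; - $1$: $u^5v,\ u^3v^3,\ uv^5,\ u^7v^7$; - $2$: $u^4,\ u^2v^2,\ v^4,\ u^6v^6$; - $3$: $uv,\ u^7v^3,\ u^5v^5,\ u^3v^7$. - Type III, by $d$ mod $2$: - $0$: $1,\ u^2v^2$; - $1$: $uv,\ u^3v^3$. -/

import Mathlib

open MvPolynomial

noncomputable section

namespace HarmonicCodes

/-! Discrete harmonic functions on `E = Fin n`. -/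

/-- The `d`-element subsets of `E`. -/
abbrev Sub (n d : ℕ) : Type := {Z : Finset (Fin n) // Z.card = d}

/-- The subsets of `E` with `d - 1` elements (there are none if `d = 0`). -/
abbrev SubPred (n d : ℕ) : Type := {Y : Finset (Fin n) // Y.card + 1 = d}

/-- The differentiation: the coefficient of `γ f` at `Y` is the sum of `f Z` over the `d`-sets
`Z` containing the `(d - 1)`-set `Y`. -/
def gamma (n d : ℕ) : (Sub n d → ℝ) →ₗ[ℝ] (SubPred n d → ℝ) where
  toFun f Y := ∑ Z : Sub n d, if Y.1 ⊆ Z.1 then f Z else 0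
  map_add' f g := by
    funext Y
    simp only [Pi.add_apply, ← Finset.sum_add_distrib]
    refine Finset.sum_congr rfl fun Z _ => ?_
    split_ifs <;> simp
  map_smul' c f := by
    funext Y
    simp only [Pi.smul_apply, smul_eq_mul, Finset.mul_sum, RingHom.id_apply]
    refine Finset.sum_congr rfl fun Z _ => ?_
    split_ifs <;> simp

/-- `Harm_d(n)`. -/
def Harm (n d : ℕ) : Submodule ℝ (Sub n d → ℝ) := LinearMap.ker (gamma n d)

/-- The extension of `f` to all subsets `X` of `E`. -/
def tilde {n d : ℕ} (f : Sub n d → ℝ) (X : Finset (Fin n)) : ℝ :=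
  ∑ Z : Sub n d, if Z.1 ⊆ X then f Z else 0

/-! Linear codes and their harmonic `m`-tuple weight enumerators. -/

/-- The support of a vector. -/
def supp {F : Type*} [Field F] {n : ℕ} (u : Fin n → F) : Finset (Fin n) :=
  open Classical in Finset.univ.filter fun i => u i ≠ 0

/-- The number of `m`-tuples of codewords whose supports have union `X`. -/
def tupleCount {F : Type*} [Field F] {n : ℕ} (C : Submodule F (Fin n → F)) (m : ℕ)
    (X : Finset (Fin n)) : ℕ :=
  Nat.card {u : Fin m → C // (Finset.univ.biUnion fun i => supp (u i : Fin n → F)) = X}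

/-- `ℂ[x, y]`. -/
abbrev Poly : Type := MvPolynomial (Fin 2) ℂ

/-- The `m`-tuple harmonic weight enumerator `W_{C,f}^{[m]}`. -/
def W {F : Type*} [Field F] {n d : ℕ} (C : Submodule F (Fin n → F)) (m : ℕ)
    (f : Sub n d → ℝ) : Poly :=
  ∑ S : Finset (Fin n),
    MvPolynomial.C ((tilde f S : ℂ) * (tupleCount C m S : ℂ)) * X 0 ^ (n - S.card) * X 1 ^ S.card

/-- The polynomial `Z_{C,f}^{[m]}`, which satisfies `W = (x y)^d Z`. -/
def Z {F : Type*} [Field F] {n d : ℕ} (C : Submodule F (Fin n → F)) (m : ℕ)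
    (f : Sub n d → ℝ) : Poly :=
  ∑ S : Finset (Fin n) with d ≤ S.card ∧ S.card + d ≤ n,
    MvPolynomial.C ((tilde f S : ℂ) * (tupleCount C m S : ℂ)) *
      X 0 ^ (n - S.card - d) * X 1 ^ (S.card - d)

/-! The four types of self-dual codes. -/

/-- The types I, II, III, IV. -/
inductive CodeType
  | I
  | II
  | III
  | IV

/-- The size `q` of the ground field. -/
def CodeType.q : CodeType → ℕ
  | .I => 2
  | .II => 2
  | .III => 3
  | .IV => 4

/-- The common divisor of the weights. -/
def CodeType.weightDivisor : CodeType → ℕ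
  | .I => 2
  | .II => 4
  | .III => 3
  | .IV => 2

/-- The order `N` of the root of unity `ω_N` in the group. -/
def CodeType.N : CodeType → ℕ
  | .I => 2
  | .II => 8
  | .III => 4
  | .IV => 2

/-- The exponent of the conjugation in the inner product: trivial for types I, II, III, and
`v ↦ v ^ √4` (Hermitian inner product over the field with four elements) for type IV. -/
def CodeType.conjExp : CodeType → ℕ
  | .I => 1
  | .II => 1
  | .III => 1
  | .IV => 2

/-- `C` is a Type `T` code: the ground field has `q` elements, `C` equals its dual (Euclidean
for types I, II, III and Hermitian for type IV), and all weights are divisible as required. -/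
structure IsTypeCode (T : CodeType) {F : Type*} [Field F] {n : ℕ}
    (C : Submodule F (Fin n → F)) : Prop where
  card_field : Nat.card F = T.q
  selfDual : ∀ v : Fin n → F, v ∈ C ↔ ∀ u ∈ C, ∑ i, u i * v i ^ T.conjExp = 0
  weights : ∀ u ∈ C, T.weightDivisor ∣ (supp u).card

/-! The groups, their characters and their relative invariants. -/

/-- `√(q ^ m)` as a complex number. -/
def root (q m : ℕ) : ℂ := (Real.sqrt ((q : ℝ) ^ m) : ℂ)

/-- The matrix `S_{m,q}`. -/
def SMat (m q : ℕ) : Matrix (Fin 2) (Fin 2) ℂ :=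
  (1 / root q m) • !![1, (q : ℂ) ^ m - 1; 1, -1]

theorem CodeType.q_pos (T : CodeType) : 0 < T.q := by
  cases T <;> simp [CodeType.q]

theorem root_mul_root (q m : ℕ) : root q m * root q m = (q : ℂ) ^ m := by
  unfold root
  rw [← Complex.ofReal_mul, Real.mul_self_sqrt (by positivity)]
  push_cast
  rfl

theorem SMat_mul_self (m q : ℕ) (hq : 0 < q) : SMat m q * SMat m q = 1 := by
  have h := root_mul_root q m
  have hq' : (q : ℂ) ≠ 0 := by exact_mod_cast hq.ne'
  have h0 : root q m ≠ 0 := by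
    intro h0
    rw [h0, zero_mul] at h
    exact pow_ne_zero m hq' h.symm
  unfold SMat
  rw [smul_mul_smul_comm, Matrix.mul_fin_two, Matrix.one_fin_two, div_mul_div_comm, h]
  ext i j
  fin_cases i <;> fin_cases j <;> simp [pow_ne_zero m hq']

/-- `S_{m,q}` as an element of `GL₂(ℂ)`. -/
def SGL (T : CodeType) (m : ℕ) : GL (Fin 2) ℂ :=
  ⟨SMat m T.q, SMat m T.q, SMat_mul_self m T.q T.q_pos, SMat_mul_self m T.q T.q_pos⟩

/-- `ω_N = exp(2πi/N)`. -/
def omega (N : ℕ) : ℂ := Complex.exp (2 * Real.pi * Complex.I / N)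

/-- The scalar matrix `ω_N I` as an element of `GL₂(ℂ)`. -/
def omegaGL (T : CodeType) : GL (Fin 2) ℂ :=
  Matrix.GeneralLinearGroup.scalar (Fin 2) (Units.mk0 (omega T.N) (Complex.exp_ne_zero _))

/-- The group `G_m^T = ⟨S_{m,q}, ω_N I⟩`. -/
def G (T : CodeType) (m : ℕ) : Subgroup (GL (Fin 2) ℂ) :=
  Subgroup.closure {SGL T m, omegaGL T}

/-- The generator `S_{m,q}` of `G_m^T`. -/
def genS (T : CodeType) (m : ℕ) : G T m :=
  ⟨SGL T m, Subgroup.subset_closure (by simp)⟩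

/-- The generator `ω_N I` of `G_m^T`. -/
def genOmega (T : CodeType) (m : ℕ) : G T m :=
  ⟨omegaGL T, Subgroup.subset_closure (by simp)⟩

/-- `χ` is the character of `G_m^T` with `χ(S_{m,q}) = (-1)^{-d}` and `χ(ω_N I) = ω_N^{-e}`. -/
def IsChar (T : CodeType) (m d e : ℕ) (χ : G T m →* ℂˣ) : Prop :=
  (χ (genS T m) : ℂ) = (-1) ^ (-(d : ℤ)) ∧ (χ (genOmega T m) : ℂ) = omega T.N ^ (-(e : ℤ))

/-- The action `(g.P)(x, y) = P(g (x, y)ᵀ)`, as an algebra homomorphism in `P`. -/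
def act (g : GL (Fin 2) ℂ) : Poly →ₐ[ℂ] Poly :=
  aeval fun i => ∑ j, C ((g : Matrix (Fin 2) (Fin 2) ℂ) i j) * X j

/-- The space `I_{G,χ}` of relative invariants of `G_m^T` with respect to `χ`. -/
def relInv {T : CodeType} {m : ℕ} (χ : G T m →* ℂˣ) : Submodule ℂ Poly where
  carrier := {P | ∀ g : G T m, act g.1 P = (χ g : ℂ) • P}
  zero_mem' g := by simp
  add_mem' hP hQ g := by rw [map_add, hP g, hQ g, smul_add]
  smul_mem' c P hP g := by rw [map_smul, hP g, smul_comm]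

/-! The generators. -/

/-- The linear form `u = x + (√(q^m) - 1) y`, which is fixed by `S_{m,q}`. -/
def u (T : CodeType) (m : ℕ) : Poly := X 0 + C (root T.q m - 1) * X 1

/-- The linear form `v = x - (√(q^m) + 1) y`, which is negated by `S_{m,q}`. -/
def v (T : CodeType) (m : ℕ) : Poly := X 0 - C (root T.q m + 1) * X 1

/-- The ring `ℂ[P₁, P₂]` with `P₁ = u ^ N` and `P₂ = v ^ N`. -/
def R (T : CodeType) (m : ℕ) : Subalgebra ℂ Poly :=
  Algebra.adjoin ℂ {u T m ^ T.N, v T m ^ T.N}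

/-- `M` is the internal direct sum of the free rank-one modules `Q i · A` over the ring `A`. -/
def IsFreeOn {r : ℕ} (A : Subalgebra ℂ Poly) (M : Submodule ℂ Poly) (Q : Fin r → Poly) : Prop :=
  LinearIndependent A Q ∧ (Submodule.span A (Set.range Q)).restrictScalars ℂ = M

end HarmonicCodes

end

open HarmonicCodes

noncomputable section

namespace HarmonicCodes

/-! ### Harmonic functions -/

/-! The proof has two independent halves.

Invariance of `Z`. A harmonic `f` of degree `d` annihilates everything of lower degree: its sums
over the `d`-sets containing a set `Y` vanish when `|Y| < d`. Hence summing `f` against a function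
of `|Z ∩ Y|` leaves only the degree `d` coefficient (`sum_harm_mul`). This yields the sign `(-1) ^
d` under complements (`tilde_compl`), the vanishing that makes `W = (xy)^d Z`, and a binomial
formula over supersets (`sum_tilde_superset`). The latter expresses `Z` through the sizes of the
shortened codes `C(S)` (`eval_Z_eq_sum_shortCard`). Self-duality relates `|C(S)|` to `|C(Sᶜ)|`, so
replacing `S` by `Sᶜ` is the MacWilliams identity, that is, covariance under `S_{m,q}`. Covariance
under `ω_N I` follows from homogeneity in degree `n - 2d` together with `N ∣ n`; for Types II and
III this divisibility is Gleason's argument, applied to the case `m = 1`, `d = 0`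
(`IsTypeCode.N_dvd`).

Structure of the relative invariants. The forms `u` and `v` are simultaneous eigenvectors of the
group, so in these coordinates it acts diagonally. A relative invariant is then exactly a
combination of monomials `u ^ a v ^ b` satisfying two congruences on `(a, b)`
(`IsChar.toUV_mem_relInv`). Dividing exponents by `N` with remainder gives a basis over `ℂ[u ^ N, v
^ N]` indexed by the admissible residue pairs (`isFreeOn_relInv`), and each table becomes a finite
check. The characters themselves are built from the eigenvalues on `u` and `v`. -/

/-- The sum of `f` over the `d`-sets containing `Y`. -/
def upSum {n d : ℕ} (f : Sub n d → ℝ) (Y : Finset (Fin n)) : ℝ :=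
  ∑ Z : Sub n d, if Y ⊆ Z.1 then f Z else 0

/-- Double counting: a `d`-set `Z ⊇ Y` contains `insert e Y` for exactly `d - |Y|` choices of `e ∉
Y`. -/
theorem sum_upSum_insert {n d : ℕ} (f : Sub n d → ℝ) (Y : Finset (Fin n)) :
    ∑ e ∈ Yᶜ, upSum f (insert e Y) = ((d : ℝ) - Y.card) * upSum f Y := by
  unfold upSum
  rw [Finset.sum_comm, Finset.mul_sum]
  refine Finset.sum_congr rfl fun Z _ => ?_
  by_cases h : Y ⊆ Z.1
  · have h1 : ∑ e ∈ Yᶜ, (if insert e Y ⊆ Z.1 then f Z else 0) = ∑ e ∈ Z.1 \ Y, f Z := by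
      rw [← Finset.sum_filter]
      refine Finset.sum_congr ?_ fun _ _ => rfl
      ext e
      simp only [Finset.mem_filter, Finset.mem_compl, Finset.insert_subset_iff, h, and_true,
        Finset.mem_sdiff]
      tauto
    rw [h1, Finset.sum_const, Finset.card_sdiff_of_subset h, nsmul_eq_mul,
      Nat.cast_sub (Finset.card_le_card h), Z.2, if_pos h]
  · rw [if_neg h, mul_zero]
    refine Finset.sum_eq_zero fun e _ => if_neg fun h' => h ?_
    exact (Finset.subset_insert e Y).trans h'

/-- Harmonicity is the case `|Y| = d - 1`. Smaller sets follow by descending induction, because the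
factor `d - |Y|` in `sum_upSum_insert` is nonzero. -/
theorem upSum_eq_zero {n d : ℕ} {f : Sub n d → ℝ} (hf : f ∈ Harm n d) {Y : Finset (Fin n)}
    (hY : Y.card < d) : upSum f Y = 0 := by
  obtain ⟨k, hk⟩ : ∃ k, Y.card + 1 + k = d := ⟨d - (Y.card + 1), by omega⟩
  induction k generalizing Y with
  | zero =>
    have h := congrFun (LinearMap.mem_ker.mp hf) ⟨Y, by omega⟩
    exact h
  | succ k ih =>
    have h := sum_upSum_insert f Y
    rw [Finset.sum_eq_zero] at h
    · have h2 : (d : ℝ) - Y.card ≠ 0 := by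
        rw [sub_ne_zero]
        exact_mod_cast hY.ne'
      exact (mul_eq_zero.mp h.symm).resolve_left h2
    · intro e he
      have hc : (insert e Y).card = Y.card + 1 :=
        Finset.card_insert_of_notMem (Finset.mem_compl.mp he)
      exact ih (by omega) (by omega)

theorem upSum_eq_zero_of_lt {n d : ℕ} (f : Sub n d → ℝ) {Y : Finset (Fin n)}
    (hY : d < Y.card) : upSum f Y = 0 := by
  refine Finset.sum_eq_zero fun Z _ => if_neg fun h => ?_
  have := Finset.card_le_card h
  have := Z.2
  omega

theorem upSum_of_card_eq {n d : ℕ} (f : Sub n d → ℝ) (Y : Sub n d) : upSum f Y.1 = f Y := by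
  unfold upSum
  rw [Finset.sum_eq_single Y]
  · simp
  · intro Z _ hZ
    refine if_neg fun h => hZ (Subtype.ext ?_)
    exact (Finset.eq_of_subset_of_card_le h (by rw [Y.2, Z.2])).symm
  · simp

/-- A function of `|Z ∩ Y|` of the form `∑ c (|V|)` over `V ⊆ Z ∩ Y`, integrated against a harmonic
function of degree `d`, only sees `c d`. -/
theorem sum_harm_mul {n d : ℕ} {f : Sub n d → ℝ} (hf : f ∈ Harm n d) (Y : Finset (Fin n))
    (c : ℕ → ℂ) :
    ∑ Z : Sub n d, (f Z : ℂ) * ∑ V ∈ (Z.1 ∩ Y).powerset, c V.card = c d * (tilde f Y : ℂ) := by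
  have h1 : ∀ Z : Sub n d, (f Z : ℂ) * ∑ V ∈ (Z.1 ∩ Y).powerset, c V.card =
      ∑ V ∈ Y.powerset, c V.card * (if V ⊆ Z.1 then (f Z : ℂ) else 0) := by
    intro Z
    rw [Finset.mul_sum]
    simp only [mul_ite, mul_zero]
    rw [← Finset.sum_filter]
    refine Finset.sum_congr ?_ fun _ _ => mul_comm _ _
    ext V
    simp only [Finset.mem_powerset, Finset.subset_inter_iff, Finset.mem_filter]
    tauto
  have h2 : ∀ V : Finset (Fin n), ∑ Z : Sub n d, c V.card * (if V ⊆ Z.1 then (f Z : ℂ) else 0) =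
      c V.card * (upSum f V : ℂ) := by
    intro V
    rw [← Finset.mul_sum, upSum]
    push_cast
    congr 1
    refine Finset.sum_congr rfl fun Z _ => ?_
    split_ifs <;> simp
  -- After exchanging the sums, `V` contributes `c |V| * upSum f V`. This vanishes for `|V| < d` by
  -- harmonicity and for `|V| > d` by cardinality.
  rw [Finset.sum_congr rfl fun Z _ => h1 Z, Finset.sum_comm, Finset.sum_congr rfl fun V _ => h2 V]
  have h3 : (tilde f Y : ℂ) = ∑ V ∈ Y.powerset with V.card = d, (upSum f V : ℂ) := by
    unfold tilde
    push_cast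
    rw [← Finset.sum_filter_of_ne (s := Finset.univ) (p := fun Z : Sub n d => Z.1 ⊆ Y)]
    · refine Finset.sum_bij (fun Z _ => Z.1) ?_ ?_ ?_ ?_
      · intro Z hZ
        simpa [Z.2] using hZ
      · intro Z _ Z' _ h
        exact Subtype.ext h
      · intro V hV
        rw [Finset.mem_filter, Finset.mem_powerset] at hV
        exact ⟨⟨V, hV.2⟩, by simpa using hV.1, rfl⟩
      · intro Z hZ
        rw [upSum_of_card_eq, if_pos (Finset.mem_filter.mp hZ).2]
    · intro Z _ hZ
      by_contra h
      exact hZ (by simp [h])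
  rw [h3, Finset.mul_sum, Finset.sum_filter]
  refine Finset.sum_congr rfl fun V _ => ?_
  split_ifs with h
  · rw [h]
  · rcases lt_or_gt_of_ne h with h | h
    · rw [upSum_eq_zero hf h]; simp
    · rw [upSum_eq_zero_of_lt f h]; simp

/-- Inclusion-exclusion writes the indicator of `Z ∩ Y = ∅` as the alternating sum over subsets of
`Z ∩ Y`; `sum_harm_mul` keeps the coefficient `(-1) ^ d`. -/
theorem tilde_compl {n d : ℕ} {f : Sub n d → ℝ} (hf : f ∈ Harm n d) (Y : Finset (Fin n)) :
    (tilde f Yᶜ : ℂ) = (-1) ^ d * (tilde f Y : ℂ) := by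
  rw [← sum_harm_mul hf Y fun k => (-1) ^ k]
  unfold tilde
  push_cast
  refine Finset.sum_congr rfl fun Z _ => ?_
  have h : ∑ V ∈ (Z.1 ∩ Y).powerset, (-1 : ℂ) ^ V.card = if Z.1 ⊆ Yᶜ then 1 else 0 := by
    have h1 := Finset.sum_powerset_neg_one_pow_card (x := Z.1 ∩ Y)
    have h2 : Z.1 ∩ Y = ∅ ↔ Z.1 ⊆ Yᶜ := by
      rw [← Finset.disjoint_iff_inter_eq_empty, le_compl_iff_disjoint_right]
    rw [if_congr h2 rfl rfl] at h1
    exact_mod_cast h1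
  rw [h]
  split_ifs <;> simp

theorem tilde_eq_zero_of_card_lt {n d : ℕ} (f : Sub n d → ℝ) {Y : Finset (Fin n)}
    (hY : Y.card < d) : tilde f Y = 0 := by
  refine Finset.sum_eq_zero fun Z _ => if_neg fun h => ?_
  have := Finset.card_le_card h
  have := Z.2
  omega

theorem tilde_eq_zero_of_lt_card_add {n d : ℕ} {f : Sub n d → ℝ} (hf : f ∈ Harm n d)
    {Y : Finset (Fin n)} (hY : n < Y.card + d) : tilde f Y = 0 := by
  have h := tilde_compl hf Y
  rw [tilde_eq_zero_of_card_lt f (Y := Yᶜ)] at h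
  · simpa using h
  · rw [Finset.card_compl, Fintype.card_fin]
    have := Finset.card_le_univ Y
    rw [Fintype.card_fin] at this
    omega

theorem sum_pow_superset {n : ℕ} (Y : Finset (Fin n)) (a b : ℂ) :
    ∑ S : Finset (Fin n) with Y ⊆ S, a ^ S.card * b ^ (n - S.card) =
      a ^ Y.card * (a + b) ^ (n - Y.card) := by
  have h := Finset.sum_pow_mul_eq_add_pow a b Yᶜ
  rw [Finset.card_compl, Fintype.card_fin] at h
  rw [← h, Finset.mul_sum]
  refine Finset.sum_bij' (fun S _ => S \ Y) (fun U _ => U ∪ Y) ?_ ?_ ?_ ?_ ?_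
  · intro S _
    rw [Finset.mem_powerset]
    intro i hi
    simp at hi ⊢
    exact hi.2
  · intro U _
    simp
  · intro S hS
    exact Finset.sdiff_union_of_subset (by simpa using hS)
  · intro U hU
    rw [Finset.mem_powerset, le_compl_iff_disjoint_right] at hU
    exact Finset.union_sdiff_cancel_right hU
  · intro S hS
    have hS : Y ⊆ S := by simpa using hS
    have h1 := Finset.card_le_card hS
    have h2 := Finset.card_le_univ S
    rw [Fintype.card_fin] at h2
    rw [Finset.card_sdiff_of_subset hS, ← mul_assoc, ← pow_add]
    congr 2 <;> omega

/-- Expanding `tilde` and summing over `S ⊇ Z ∪ Y` leaves a weight depending only on `|Z ∩ Y|`. That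
weight is a binomial sum of `b ^ |V| * a ^ (d - |V|)` over `V ⊆ Z ∩ Y`, of which `sum_harm_mul`
retains the term `b ^ d`. -/
theorem sum_tilde_superset {n d : ℕ} {f : Sub n d → ℝ} (hf : f ∈ Harm n d) (Y : Finset (Fin n))
    (a b : ℂ) :
    ∑ S : Finset (Fin n) with Y ⊆ S, (tilde f S : ℂ) * (a ^ S.card * b ^ (n - S.card)) =
      (tilde f Y : ℂ) * (a ^ Y.card * (a + b) ^ (n - Y.card - d) * b ^ d) := by
  -- In this range the exponent `n - |Y| - d` is truncated, but every `tilde` value involved is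
  -- zero.
  by_cases hY : n < Y.card + d
  · rw [tilde_eq_zero_of_lt_card_add hf hY, Finset.sum_eq_zero]
    · simp
    · intro S hS
      have hS : Y ⊆ S := by simpa using hS
      have := Finset.card_le_card hS
      rw [tilde_eq_zero_of_lt_card_add hf (by omega)]
      simp
  push Not at hY
  have h1 : ∑ S : Finset (Fin n) with Y ⊆ S, (tilde f S : ℂ) * (a ^ S.card * b ^ (n - S.card)) =
      ∑ Z : Sub n d, (f Z : ℂ) * (a ^ (Z.1 ∪ Y).card * (a + b) ^ (n - (Z.1 ∪ Y).card)) := by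
    unfold tilde
    push_cast
    simp only [Finset.sum_mul]
    rw [Finset.sum_comm]
    refine Finset.sum_congr rfl fun Z _ => ?_
    rw [← sum_pow_superset, Finset.mul_sum, Finset.sum_filter, Finset.sum_filter]
    refine Finset.sum_congr rfl fun S _ => ?_
    by_cases h1 : Y ⊆ S <;> by_cases h2 : Z.1 ⊆ S <;> simp [h1, h2, Finset.union_subset_iff]
  have h2 : ∀ Z : Sub n d, a ^ (Z.1 ∪ Y).card * (a + b) ^ (n - (Z.1 ∪ Y).card) =
      (∑ V ∈ (Z.1 ∩ Y).powerset, b ^ V.card * a ^ (d - V.card)) *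
        (a ^ Y.card * (a + b) ^ (n - Y.card - d)) := by
    intro Z
    have h3 := Finset.sum_pow_mul_eq_add_pow b a (Z.1 ∩ Y)
    have h4 := Finset.card_union_add_card_inter Z.1 Y
    have h5 := Finset.card_le_card (Finset.inter_subset_left : Z.1 ∩ Y ⊆ Z.1)
    rw [Z.2] at h4 h5
    have h6 : ∑ V ∈ (Z.1 ∩ Y).powerset, b ^ V.card * a ^ (d - V.card) =
        (b + a) ^ (Z.1 ∩ Y).card * a ^ (d - (Z.1 ∩ Y).card) := by
      rw [← h3, Finset.sum_mul]
      refine Finset.sum_congr rfl fun V hV => ?_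
      have h7 := Finset.card_le_card (Finset.mem_powerset.mp hV)
      rw [mul_assoc, ← pow_add]
      congr 2
      omega
    have h8 : n - (Z.1 ∪ Y).card = (n - Y.card - d) + (Z.1 ∩ Y).card := by omega
    have h9 : (Z.1 ∪ Y).card = Y.card + (d - (Z.1 ∩ Y).card) := by omega
    rw [h6, h8, h9, add_comm b a, pow_add, pow_add]
    ring
  rw [h1]
  simp only [h2, ← mul_assoc]
  simp only [← Finset.sum_mul]
  rw [sum_harm_mul hf Y fun k => b ^ k * a ^ (d - k), Nat.sub_self]
  ring

/-! ### Shortened codes and duality -/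

section Codes

variable {F : Type*} [Field F] {n : ℕ}

/-- The vectors of `F ^ n` with support in `S`. -/
def supportedOn (F : Type*) [Field F] {n : ℕ} (S : Finset (Fin n)) : Submodule F (Fin n → F) :=
  ⨅ i ∈ (↑(Sᶜ) : Set (Fin n)), LinearMap.ker (LinearMap.proj i : (Fin n → F) →ₗ[F] F)

theorem mem_supportedOn {S : Finset (Fin n)} {w : Fin n → F} :
    w ∈ supportedOn F S ↔ ∀ i, i ∉ S → w i = 0 := by
  simp [supportedOn, Submodule.mem_iInf]

theorem mem_supportedOn_iff_supp {S : Finset (Fin n)} {w : Fin n → F} :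
    w ∈ supportedOn F S ↔ supp w ⊆ S := by
  rw [mem_supportedOn]
  simp only [supp, Finset.subset_iff, Finset.mem_filter, Finset.mem_univ, true_and]
  exact forall_congr' fun i => by tauto

theorem finrank_supportedOn (S : Finset (Fin n)) :
    Module.finrank F (supportedOn F S) = S.card := by
  have e := LinearMap.iInfKerProjEquiv F (fun _ : Fin n => F) (I := (S : Set (Fin n)))
    (J := (↑(Sᶜ) : Set (Fin n))) (by simpa using disjoint_compl_right) (by simp)
  rw [supportedOn, e.finrank_eq, Module.finrank_fintype_fun_eq_card]
  simp

/-- The Euclidean dual of a code. -/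
def dualCode (C : Submodule F (Fin n → F)) : Submodule F (Fin n → F) :=
  LinearMap.BilinForm.orthogonal (dotProductBilin F F) C

theorem mem_dualCode {C : Submodule F (Fin n → F)} {w : Fin n → F} :
    w ∈ dualCode C ↔ ∀ c ∈ C, ∑ i, c i * w i = 0 :=
  Iff.rfl

theorem dualCode_sup_supportedOn (C : Submodule F (Fin n → F)) (S : Finset (Fin n)) :
    dualCode (C ⊔ supportedOn F S) = dualCode C ⊓ supportedOn F Sᶜ := by
  ext w
  rw [Submodule.mem_inf, mem_supportedOn, mem_dualCode, mem_dualCode]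
  constructor
  · intro h
    refine ⟨fun c hc => h c (Submodule.mem_sup_left hc), fun i hi => ?_⟩
    have h1 := h (Pi.single i 1) (Submodule.mem_sup_right (mem_supportedOn.mpr fun j hj => ?_))
    · simpa [Pi.single_apply] using h1
    · have : j ≠ i := by
        rintro rfl
        exact hj (by simpa using hi)
      simp [this]
  · rintro ⟨h1, h2⟩ c hc
    obtain ⟨a, ha, b, hb, rfl⟩ := Submodule.mem_sup.mp hc
    simp only [Pi.add_apply, add_mul, Finset.sum_add_distrib, h1 a ha, zero_add]
    refine Finset.sum_eq_zero fun i _ => ?_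
    by_cases hi : i ∈ S
    · rw [h2 i (by simpa using hi), mul_zero]
    · rw [mem_supportedOn.mp hb i hi, zero_mul]

theorem finrank_add_finrank_dualCode (C : Submodule F (Fin n → F)) :
    Module.finrank F C + Module.finrank F (dualCode C) = n := by
  have h := LinearMap.BilinForm.finrank_add_finrank_orthogonal'
    (B := (dotProductBilin F F : LinearMap.BilinForm F (Fin n → F))) C
  have h1 : LinearMap.ker (dotProductBilin F F : LinearMap.BilinForm F (Fin n → F)) = ⊥ := by
    rw [LinearMap.ker_eq_bot']
    intro w hw
    funext i
    simpa using LinearMap.congr_fun hw (Pi.single i 1)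
  have h2 : C ⊓ LinearMap.ker (dotProductBilin F F : LinearMap.BilinForm F (Fin n → F)) = ⊥ := by
    rw [h1, inf_bot_eq]
  rw [h2, finrank_bot, add_zero, Module.finrank_fin_fun] at h
  exact h

/-- The dimension formula for `C + F^S`, whose dual is the part of the dual code supported on `Sᶜ`.
-/
theorem finrank_inf_supportedOn (C : Submodule F (Fin n → F)) (S : Finset (Fin n)) :
    Module.finrank F (C ⊓ supportedOn F S : Submodule F (Fin n → F)) + Module.finrank F (dualCode C) =
      S.card + Module.finrank F (dualCode C ⊓ supportedOn F Sᶜ : Submodule F (Fin n → F)) := by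
  have h1 := Submodule.finrank_sup_add_finrank_inf_eq C (supportedOn F S)
  have h2 := finrank_add_finrank_dualCode (C ⊔ supportedOn F S)
  have h3 := finrank_add_finrank_dualCode C
  rw [dualCode_sup_supportedOn] at h2
  rw [finrank_supportedOn] at h1
  omega

/-- Conjugation being a field automorphism lets the Hermitian case be reduced to the Euclidean dual.
For Type IV, order `4` forces characteristic `2`. -/
theorem CodeType.frobenius (T : CodeType) (hF : Nat.card F = T.q) :
    ∃ σ : F →+* F, ∀ a, σ a = a ^ T.conjExp := by
  cases T
  case IV =>
    have : Finite F := Nat.finite_of_card_ne_zero (by rw [hF]; decide)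
    have := Fintype.ofFinite F
    have h2 : CharP F 2 := by
      obtain ⟨p, hp⟩ := CharP.exists F
      have hpp := CharP.char_is_prime F p
      have h := FiniteField.card F p
      obtain ⟨k, _, hk⟩ := h
      rw [← Nat.card_eq_fintype_card, hF] at hk
      have h4 : p ∣ 2 ^ 2 := by
        change (4 : ℕ) = _ at hk
        rw [show 2 ^ 2 = 4 from rfl, hk]
        exact dvd_pow_self p k.ne_zero
      have h5 := (Nat.prime_dvd_prime_iff_eq hpp Nat.prime_two).mp (hpp.dvd_of_dvd_pow h4)
      rwa [h5] at hp
    have : Fact (Nat.Prime 2) := ⟨Nat.prime_two⟩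
    exact ⟨_root_.frobenius F 2, fun a => rfl⟩
  all_goals exact ⟨RingHom.id F, fun a => (pow_one a).symm⟩

/-- For a code of one of the four types, `C(S)` and `C^⊥(S)` have the same size. -/
theorem IsTypeCode.card_dualCode_inf {T : CodeType} {C : Submodule F (Fin n → F)}
    (hC : IsTypeCode T C) (S : Finset (Fin n)) :
    Nat.card (dualCode C ⊓ supportedOn F S : Submodule F (Fin n → F)) =
      Nat.card (C ⊓ supportedOn F S : Submodule F (Fin n → F)) := by
  have : Finite F := Nat.finite_of_card_ne_zero (by rw [hC.card_field]; exact T.q_pos.ne')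
  obtain ⟨σ, hσ⟩ := T.frobenius hC.card_field
  have hb : Function.Bijective σ := Finite.injective_iff_bijective.mp σ.injective
  -- Coordinatewise conjugation preserves supports and, by `selfDual`, carries `C` onto its
  -- Euclidean dual.
  have hmem : ∀ w : Fin n → F, w ∈ C ⊓ supportedOn F S ↔
      (fun i => σ (w i)) ∈ dualCode C ⊓ supportedOn F S := by
    intro w
    rw [Submodule.mem_inf, Submodule.mem_inf, mem_supportedOn, mem_supportedOn, mem_dualCode,
      hC.selfDual]
    simp only [hσ]
    refine and_congr Iff.rfl (forall_congr' fun i => imp_congr_right fun _ => ?_)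
    rw [← hσ, map_eq_zero]
  symm
  refine Nat.card_congr ((Equiv.arrowCongr (Equiv.refl (Fin n))
    (Equiv.ofBijective σ hb)).subtypeEquiv fun w => ?_)
  exact hmem w

theorem IsTypeCode.finrank_dualCode_inf {T : CodeType} {C : Submodule F (Fin n → F)}
    (hC : IsTypeCode T C) (S : Finset (Fin n)) :
    Module.finrank F (dualCode C ⊓ supportedOn F S : Submodule F (Fin n → F)) =
      Module.finrank F (C ⊓ supportedOn F S : Submodule F (Fin n → F)) := by
  have : Finite F := Nat.finite_of_card_ne_zero (by rw [hC.card_field]; exact T.q_pos.ne')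
  have h := hC.card_dualCode_inf S
  rw [Module.natCard_eq_pow_finrank (K := F)
    (V := (dualCode C ⊓ supportedOn F S : Submodule F (Fin n → F))), Module.natCard_eq_pow_finrank (K := F)
    (V := (C ⊓ supportedOn F S : Submodule F (Fin n → F)))] at h
  exact Nat.pow_right_injective Finite.one_lt_card h

theorem IsTypeCode.two_mul_finrank {T : CodeType} {C : Submodule F (Fin n → F)}
    (hC : IsTypeCode T C) : 2 * Module.finrank F C = n := by
  have h := hC.finrank_dualCode_inf Finset.univ
  have h1 : supportedOn F (Finset.univ : Finset (Fin n)) = ⊤ := by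
    rw [eq_top_iff]
    intro w _
    simp [mem_supportedOn]
  rw [h1, inf_top_eq, inf_top_eq] at h
  have := finrank_add_finrank_dualCode C
  omega

/-- The number of codewords with support in `S`. -/
def shortCard (C : Submodule F (Fin n → F)) (S : Finset (Fin n)) : ℕ :=
  Nat.card (C ⊓ supportedOn F S : Submodule F (Fin n → F))

/-- The relation `|C(S)| = q ^ (|S| - n/2) * |C(Sᶜ)|`, squared and cleared of denominators so that
all exponents are natural numbers. -/
theorem IsTypeCode.shortCard_mul {T : CodeType} {C : Submodule F (Fin n → F)}
    (hC : IsTypeCode T C) (S : Finset (Fin n)) :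
    shortCard C S ^ 2 * T.q ^ n = T.q ^ (2 * S.card) * shortCard C Sᶜ ^ 2 := by
  have : Finite F := Nat.finite_of_card_ne_zero (by rw [hC.card_field]; exact T.q_pos.ne')
  have h1 := finrank_inf_supportedOn C S
  have h2 := hC.two_mul_finrank
  have h3 := finrank_add_finrank_dualCode C
  have h4 := hC.finrank_dualCode_inf Sᶜ
  rw [shortCard, shortCard, Module.natCard_eq_pow_finrank (K := F)
    (V := (C ⊓ supportedOn F S : Submodule F (Fin n → F))),
    Module.natCard_eq_pow_finrank (K := F)
    (V := (C ⊓ supportedOn F Sᶜ : Submodule F (Fin n → F))), hC.card_field, ← pow_mul, ← pow_mul, ← pow_add,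
    ← pow_add]
  congr 1
  omega

/-- The tuples whose supports have union inside `S` are exactly the `m`-tuples of codewords of
`C(S)`. -/
theorem sum_tupleCount [Finite F] (C : Submodule F (Fin n → F)) (m : ℕ) (S : Finset (Fin n)) :
    ∑ Y : Finset (Fin n) with Y ⊆ S, tupleCount C m Y = shortCard C S ^ m := by
  classical
  have := Fintype.ofFinite (Fin m → C)
  have h1 : shortCard C S ^ m =
      Nat.card (Fin m → (C ⊓ supportedOn F S : Submodule F (Fin n → F))) := by
    rw [Nat.card_fun, shortCard, Nat.card_fin]
  let U : (Fin m → C) → Finset (Fin n) :=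
    fun w => Finset.univ.biUnion fun i => supp (w i : Fin n → F)
  have h2 : Nat.card (Fin m → (C ⊓ supportedOn F S : Submodule F (Fin n → F))) =
      Nat.card {w : Fin m → C // U w ⊆ S} := by
    refine Nat.card_congr ⟨fun w => ⟨fun i => ⟨(w i).1, (w i).2.1⟩, ?_⟩,
      fun w i => ⟨(w.1 i).1, (w.1 i).2, ?_⟩, fun w => rfl, fun w => rfl⟩
    · exact Finset.biUnion_subset.mpr fun i _ => mem_supportedOn_iff_supp.mp (w i).2.2
    · exact mem_supportedOn_iff_supp.mpr (Finset.biUnion_subset.mp w.2 i (Finset.mem_univ i))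
  rw [h1, h2, Nat.card_eq_fintype_card, Fintype.card_subtype,
    Finset.card_eq_sum_card_fiberwise (f := U) (t := Finset.univ.filter fun Y => Y ⊆ S)]
  · refine Finset.sum_congr rfl fun Y hY => ?_
    rw [tupleCount, Nat.card_eq_fintype_card, Fintype.card_subtype]
    congr 1
    ext w
    simp only [Finset.mem_filter, Finset.mem_univ, true_and] at hY ⊢
    constructor
    · exact fun h => ⟨(show U w = Y from h) ▸ hY, h⟩
    · exact fun h => h.2
  · intro w hw
    simpa using hw

end Codes

/-! ### The MacWilliams identity -/

section MacWilliams

variable {F : Type*} [Field F] {n d : ℕ}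

theorem eval_act (g : GL (Fin 2) ℂ) (P : Poly) (x y : ℂ) :
    eval ![x, y] (act g P) = eval ![g 0 0 * x + g 0 1 * y, g 1 0 * x + g 1 1 * y] P := by
  unfold act
  rw [aeval_def, ← MvPolynomial.coe_eval₂Hom, ← RingHom.comp_apply]
  congr 1
  ext i
  · simp
  · fin_cases i <;> simp [Fin.sum_univ_two]

theorem W_eq {f : Sub n d → ℝ} (hf : f ∈ Harm n d) (C : Submodule F (Fin n → F)) (m : ℕ) :
    W C m f = (X 0 * X 1) ^ d * Z C m f := by
  unfold W Z
  rw [Finset.mul_sum, Finset.sum_filter]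
  refine Finset.sum_congr rfl fun S _ => ?_
  split_ifs with h
  · have e1 : (X 0 : Poly) ^ (n - S.card) = X 0 ^ (n - S.card - d) * X 0 ^ d := by
      rw [← pow_add, Nat.sub_add_cancel (by omega)]
    have e2 : (X 1 : Poly) ^ S.card = X 1 ^ (S.card - d) * X 1 ^ d := by
      rw [← pow_add, Nat.sub_add_cancel h.1]
    rw [e1, e2]
    ring
  · have h0 : tilde f S = 0 := by
      by_cases h1 : S.card < d
      · exact tilde_eq_zero_of_card_lt f h1
      · exact tilde_eq_zero_of_lt_card_add hf (by omega)
    simp [h0]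

theorem eval_Z (f : Sub n d → ℝ) (C : Submodule F (Fin n → F)) (m : ℕ) (x y : ℂ) :
    eval ![x, y] (Z C m f) = ∑ S : Finset (Fin n) with d ≤ S.card ∧ S.card + d ≤ n,
      (tilde f S : ℂ) * (tupleCount C m S : ℂ) * x ^ (n - S.card - d) * y ^ (S.card - d) := by
  simp [Z]

/-- Expand `|C(S)| ^ m` by `sum_tupleCount`, exchange the sums, and evaluate the sum over `S ⊇ Y` by
`sum_tilde_superset`. The prefactor collects `b ^ d` and the `a ^ d` split off from `a ^ |Y|`. -/
theorem eval_Z_eq_sum_shortCard [Finite F] {f : Sub n d → ℝ} (hf : f ∈ Harm n d)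
    (C : Submodule F (Fin n → F)) (m : ℕ) (a b : ℂ) :
    (a * b) ^ d * eval ![a + b, a] (Z C m f) =
      ∑ S : Finset (Fin n),
        (tilde f S : ℂ) * (shortCard C S : ℂ) ^ m * (a ^ S.card * b ^ (n - S.card)) := by
  have h1 : ∀ S : Finset (Fin n), (shortCard C S : ℂ) ^ m =
      ∑ Y : Finset (Fin n), if Y ⊆ S then (tupleCount C m Y : ℂ) else 0 := by
    intro S
    rw [← Finset.sum_filter]
    exact_mod_cast (sum_tupleCount C m S).symm
  have h2 : ∀ S : Finset (Fin n),
      (tilde f S : ℂ) * (shortCard C S : ℂ) ^ m * (a ^ S.card * b ^ (n - S.card)) =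
        ∑ Y : Finset (Fin n), (tupleCount C m Y : ℂ) *
          if Y ⊆ S then (tilde f S : ℂ) * (a ^ S.card * b ^ (n - S.card)) else 0 := by
    intro S
    rw [h1, Finset.mul_sum, Finset.sum_mul]
    refine Finset.sum_congr rfl fun Y _ => ?_
    split_ifs <;> ring
  rw [Finset.sum_congr rfl fun S _ => h2 S, Finset.sum_comm, eval_Z, Finset.mul_sum,
    Finset.sum_filter]
  refine Finset.sum_congr rfl fun Y _ => ?_
  rw [← Finset.mul_sum, ← Finset.sum_filter, sum_tilde_superset hf]
  split_ifs with h
  · conv_rhs => rw [← Nat.sub_add_cancel h.1, pow_add]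
    rw [show n - (Y.card - d + d) - d = n - Y.card - d by omega]
    ring
  · have h0 : tilde f Y = 0 := by
      by_cases h1 : Y.card < d
      · exact tilde_eq_zero_of_card_lt f h1
      · exact tilde_eq_zero_of_lt_card_add hf (by omega)
    simp [h0]

theorem root_ne_zero (q m : ℕ) (hq : 0 < q) : root q m ≠ 0 := by
  intro h0
  have h := root_mul_root q m
  have hq' : (q : ℂ) ≠ 0 := by exact_mod_cast hq.ne'
  rw [h0, zero_mul] at h
  exact pow_ne_zero m hq' h.symm

theorem IsTypeCode.shortCard_pow_mul {T : CodeType} {C : Submodule F (Fin n → F)}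
    (hC : IsTypeCode T C) (m : ℕ) (S : Finset (Fin n)) :
    (shortCard C S : ℂ) ^ m * root T.q m ^ n =
      root T.q m ^ (2 * S.card) * (shortCard C Sᶜ : ℂ) ^ m := by
  have h := hC.shortCard_mul S
  set s : ℝ := Real.sqrt ((T.q : ℝ) ^ m) with hs
  have hs2 : s ^ 2 = (T.q : ℝ) ^ m := Real.sq_sqrt (by positivity)
  have h0 : 0 ≤ s := Real.sqrt_nonneg _
  -- Both sides are nonnegative reals, so it suffices to compare squares; this is the `m`-th power
  -- of `shortCard_mul`.
  have key : (shortCard C S : ℝ) ^ m * s ^ n = s ^ (2 * S.card) * (shortCard C Sᶜ : ℝ) ^ m := by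
    rw [← sq_eq_sq₀ (by positivity) (by positivity), mul_pow, mul_pow, ← pow_mul s, mul_comm n 2,
      pow_mul s 2, hs2, pow_mul s 2, hs2]
    have h' : ((shortCard C S : ℝ) ^ 2 * (T.q : ℝ) ^ n) ^ m =
        ((T.q : ℝ) ^ (2 * S.card) * (shortCard C Sᶜ : ℝ) ^ 2) ^ m := by
      congr 1
      exact_mod_cast h
    rw [mul_pow, mul_pow] at h'
    calc _ = ((shortCard C S : ℝ) ^ 2) ^ m * ((T.q : ℝ) ^ n) ^ m := by ring
      _ = _ := h'
      _ = _ := by ring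
  have h' := congrArg (fun r : ℝ => (r : ℂ)) key
  push_cast at h'
  exact h'

/-- With `r = √(q^m)`, replacing `S` by `Sᶜ` in the shortened-code sum turns `(a, b)` into `(b / r,
r * a)`, which preserves the product `a * b`; the sign comes from `tilde_compl`. -/
theorem IsTypeCode.eval_Z {T : CodeType} {C : Submodule F (Fin n → F)}
    (hC : IsTypeCode T C) (m : ℕ) {f : Sub n d → ℝ} (hf : f ∈ Harm n d) (a b : ℂ) :
    (a * b) ^ d * eval ![a + b, a] (Z C m f) =
      (-1) ^ d * ((a * b) ^ d *
        eval ![b / root T.q m + root T.q m * a, b / root T.q m] (Z C m f)) := by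
  have : Finite F := Nat.finite_of_card_ne_zero (by rw [hC.card_field]; exact T.q_pos.ne')
  have hr := root_ne_zero T.q m T.q_pos
  have h1 : (a * b) ^ d = (b / root T.q m * (root T.q m * a)) ^ d := by
    congr 1
    field_simp
  conv_rhs => rw [h1]
  rw [eval_Z_eq_sum_shortCard hf, eval_Z_eq_sum_shortCard hf, Finset.mul_sum]
  refine Finset.sum_bij' (fun S _ => Sᶜ) (fun S _ => Sᶜ) (by simp) (by simp) (by simp) (by simp) ?_
  intro S _
  have h2 := hC.shortCard_pow_mul m S
  have hS := Finset.card_le_univ S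
  rw [Fintype.card_fin] at hS
  have h4 : ((-1 : ℂ) ^ d) * (-1) ^ d = 1 := by
    rw [← mul_pow]
    simp
  have h5 : (shortCard C S : ℂ) ^ m * root T.q m ^ (n - S.card) =
      root T.q m ^ S.card * (shortCard C Sᶜ : ℂ) ^ m := by
    apply mul_left_cancel₀ (pow_ne_zero S.card hr)
    calc _ = (shortCard C S : ℂ) ^ m * root T.q m ^ (S.card + (n - S.card)) := by ring
      _ = _ := by rw [Nat.add_sub_cancel' hS, h2]; ring
  rw [tilde_compl hf, Finset.card_compl, Fintype.card_fin, Nat.sub_sub_self hS, div_pow, mul_pow,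
    show ((-1 : ℂ) ^ d) * ((-1) ^ d * ↑(tilde f S) * (shortCard C Sᶜ : ℂ) ^ m *
      (b ^ (n - S.card) / root T.q m ^ (n - S.card) * (root T.q m ^ S.card * a ^ S.card))) =
      ((-1 : ℂ) ^ d * (-1) ^ d) * ↑(tilde f S) * ((root T.q m ^ S.card * (shortCard C Sᶜ : ℂ) ^ m) /
      root T.q m ^ (n - S.card)) * (a ^ S.card * b ^ (n - S.card)) by ring, h4, ← h5,
    mul_div_cancel_right₀ _ (pow_ne_zero _ hr), one_mul]

/-- The MacWilliams identity for the harmonic `m`-tuple weight enumerator of a self-dual code. -/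
theorem IsTypeCode.act_SGL_Z {T : CodeType} {C : Submodule F (Fin n → F)}
    (hC : IsTypeCode T C) (m : ℕ) {f : Sub n d → ℝ} (hf : f ∈ Harm n d) :
    act (SGL T m) (Z C m f) = (-1 : ℂ) ^ d • Z C m f := by
  have hr := root_ne_zero T.q m T.q_pos
  have hrr := root_mul_root T.q m
  -- The identity is available only after multiplication by `(a * b) ^ d`. Taking `a = y`, `b = x -
  -- y` makes `(a + b, a) = (x, y)`, and the transformed point is the image of `(x, y)` under
  -- `S_{m,q}`.
  have h0 : ((X 1 * (X 0 - X 1)) ^ d : Poly) ≠ 0 := by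
    refine pow_ne_zero d fun h => ?_
    have := congrArg (eval ![2, 1]) h
    norm_num at this
  apply mul_left_cancel₀ h0
  refine MvPolynomial.funext fun p => ?_
  obtain ⟨x, y, rfl⟩ : ∃ x y, p = ![x, y] := ⟨p 0, p 1, by ext i; fin_cases i <;> rfl⟩
  have h := hC.eval_Z m hf y (x - y)
  have h4 : ((-1 : ℂ) ^ d) * (-1) ^ d = 1 := by
    rw [← mul_pow]
    simp
  have e1 : (1 / root T.q m) * x + (1 / root T.q m) * ((T.q : ℂ) ^ m - 1) * y =
      (x - y) / root T.q m + root T.q m * y := by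
    rw [← hrr]
    field_simp
    ring
  have e2 : (1 / root T.q m) * x + -(1 / root T.q m) * y = (x - y) / root T.q m := by
    ring
  have hS : (SGL T m : Matrix (Fin 2) (Fin 2) ℂ) = SMat m T.q := rfl
  rw [map_mul, map_mul, eval_act, smul_eval]
  simp only [map_pow, map_mul, map_sub, eval_X, hS]
  simp only [SMat, Matrix.smul_apply, Matrix.of_apply, Matrix.cons_val_zero, Matrix.cons_val_one,
    smul_eq_mul, mul_one, mul_neg, e1, e2]
  rw [add_sub_cancel] at h
  calc _ = ((-1 : ℂ) ^ d * (-1) ^ d) * ((y * (x - y)) ^ d *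
        eval ![(x - y) / root T.q m + root T.q m * y, (x - y) / root T.q m] (Z C m f)) := by
        rw [h4, one_mul]
    _ = (-1) ^ d * ((-1) ^ d * ((y * (x - y)) ^ d *
        eval ![(x - y) / root T.q m + root T.q m * y, (x - y) / root T.q m] (Z C m f))) := by
        rw [mul_assoc]
    _ = _ := by rw [← h]; ring

end MacWilliams

/-! ### Divisibility of the length of a self-dual code -/

section Length

variable {F : Type*} [Field F] {n : ℕ}

theorem one_mem_Harm_zero : (fun _ => 1 : Sub n 0 → ℝ) ∈ Harm n 0 := by
  refine LinearMap.mem_ker.mpr (funext fun Y => ?_)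
  exact absurd Y.2 (Nat.succ_ne_zero _)

theorem tilde_one (S : Finset (Fin n)) : tilde (fun _ => 1 : Sub n 0 → ℝ) S = 1 := by
  unfold tilde
  have : Unique (Sub n 0) :=
    { default := ⟨∅, rfl⟩
      uniq := fun Z => Subtype.ext (Finset.card_eq_zero.mp Z.2) }
  rw [Fintype.sum_unique, if_pos]
  rw [Finset.card_eq_zero.mp (default : Sub n 0).2]
  exact Finset.empty_subset S

/-- The ordinary weight enumerator of `C`, as a function. -/
def weightEnum (C : Submodule F (Fin n → F)) (x y : ℂ) : ℂ :=
  eval ![x, y] (Z C 1 (fun _ => 1 : Sub n 0 → ℝ))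

theorem weightEnum_eq (C : Submodule F (Fin n → F)) (x y : ℂ) :
    weightEnum C x y =
      ∑ S : Finset (Fin n), (tupleCount C 1 S : ℂ) * x ^ (n - S.card) * y ^ S.card := by
  rw [weightEnum, eval_Z, Finset.filter_true_of_mem]
  · simp [tilde_one]
  · intro S _
    simpa using Finset.card_le_univ S

theorem supp_zero : supp (0 : Fin n → F) = ∅ := by
  simp [supp]

theorem supp_eq_empty {w : Fin n → F} (h : supp w = ∅) : w = 0 := by
  funext i
  by_contra hi
  have : i ∈ supp w := by simpa [supp] using hi
  simp [h] at this

theorem tupleCount_one_empty (C : Submodule F (Fin n → F)) : tupleCount C 1 ∅ = 1 := by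
  rw [tupleCount, Nat.card_eq_one_iff_unique]
  refine ⟨⟨fun a b => Subtype.ext (funext fun i => Subtype.ext ?_)⟩,
    ⟨⟨0, Finset.subset_empty.mp (Finset.biUnion_subset.mpr fun i _ => supp_zero.le)⟩⟩⟩
  rw [supp_eq_empty (Finset.subset_empty.mp (Finset.biUnion_subset.mp a.2.le i (Finset.mem_univ i))),
    supp_eq_empty (Finset.subset_empty.mp (Finset.biUnion_subset.mp b.2.le i (Finset.mem_univ i)))]

theorem weightEnum_zero (C : Submodule F (Fin n → F)) (x : ℂ) : weightEnum C x 0 = x ^ n := by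
  rw [weightEnum_eq, Finset.sum_eq_single ∅]
  · simp [tupleCount_one_empty]
  · intro S _ hS
    rw [zero_pow (Finset.card_ne_zero.mpr (Finset.nonempty_iff_ne_empty.mpr hS)), mul_zero]
  · simp

/-- Only supports of codewords contribute, and their sizes are multiples of the weight divisor. -/
theorem IsTypeCode.weightEnum_mul {T : CodeType} {C : Submodule F (Fin n → F)}
    (hC : IsTypeCode T C) {ζ : ℂ} (hζ : ζ ^ T.weightDivisor = 1) (x y : ℂ) :
    weightEnum C x (ζ * y) = weightEnum C x y := by
  rw [weightEnum_eq, weightEnum_eq]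
  refine Finset.sum_congr rfl fun S _ => ?_
  by_cases h : tupleCount C 1 S = 0
  · simp [h]
  · obtain ⟨w, hw⟩ := (Nat.card_ne_zero.mp h).1
    have h1 : supp (w 0 : Fin n → F) = S := by simpa using hw
    obtain ⟨k, hk⟩ := hC.weights _ (w 0).2
    rw [h1] at hk
    rw [hk, mul_pow, pow_mul ζ, hζ, one_pow, one_mul]

theorem IsTypeCode.weightEnum_SMat {T : CodeType} {C : Submodule F (Fin n → F)}
    (hC : IsTypeCode T C) (x y : ℂ) :
    weightEnum C ((x + ((T.q : ℂ) - 1) * y) / root T.q 1) ((x - y) / root T.q 1) =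
      weightEnum C x y := by
  have h := congrArg (eval ![x, y]) (hC.act_SGL_Z 1 one_mem_Harm_zero)
  rw [eval_act, pow_zero, one_smul] at h
  have hS : (SGL T 1 : Matrix (Fin 2) (Fin 2) ℂ) = SMat 1 T.q := rfl
  simp only [hS, SMat, Matrix.smul_apply, Matrix.of_apply, Matrix.cons_val_zero,
    Matrix.cons_val_one, smul_eq_mul, mul_one, mul_neg, pow_one] at h
  rw [weightEnum, weightEnum, ← h]
  congr 3 <;> ring_nf

/-- The relation `(S T)³ ∈ ℂ I` for `T = diag(1, ζ)`, evaluated on the weight enumerator. -/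
theorem IsTypeCode.pow_length_eq_one {T : CodeType} {C : Submodule F (Fin n → F)}
    (hC : IsTypeCode T C) {ζ : ℂ} (hζ : ζ ^ T.weightDivisor = 1)
    (h : 1 + ((T.q : ℂ) - 1) * ζ = ζ * (1 - ζ)) :
    ((1 + ((T.q : ℂ) - 1) * ζ) / root T.q 1) ^ n = 1 := by
  have hstep : ∀ x y, weightEnum C ((x + ((T.q : ℂ) - 1) * (ζ * y)) / root T.q 1)
      ((x - ζ * y) / root T.q 1) = weightEnum C x y := by
    intro x y
    rw [hC.weightEnum_SMat, hC.weightEnum_mul hζ]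
  have hr := root_ne_zero T.q 1 T.q_pos
  have hrr : root T.q 1 ^ 2 = T.q := by rw [sq, root_mul_root, pow_one]
  have hq : (T.q : ℂ) ≠ 0 := by exact_mod_cast T.q_pos.ne'
  have h1 := hstep 1 0
  -- Three steps from `(1, 0)` end on the axis `y = 0`: `h` is the vanishing of the second
  -- coordinate, and it also reduces the first to `(1 + (q - 1) ζ) / √q`. On that axis the
  -- enumerator is `x ^ n`.
  rw [← hstep, ← hstep, weightEnum_zero, one_pow] at h1
  refine Eq.trans ?_ h1
  rw [← weightEnum_zero C]
  have key : ∀ a b a' b', a = a' → b = b' → weightEnum C a b = weightEnum C a' b' := by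
    rintro a b _ _ rfl rfl
    rfl
  apply key
  · field_simp
    rw [hrr]
    linear_combination ((T.q : ℂ) - 1) * h
  · field_simp
    linear_combination -h

/-- For Types I and IV, `n = 2 dim C`. For Types II and III, take `ζ = i` and `ζ` a primitive cube
root of unity: the number `c` with `c ^ n = 1` then has order exactly `8` and `4`. -/
theorem IsTypeCode.N_dvd {T : CodeType} {C : Submodule F (Fin n → F)} (hC : IsTypeCode T C) :
    T.N ∣ n := by
  cases T
  case I => exact ⟨_, hC.two_mul_finrank.symm⟩
  case IV => exact ⟨_, hC.two_mul_finrank.symm⟩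
  case II =>
    have h := hC.pow_length_eq_one (ζ := Complex.I) Complex.I_pow_four (by
      simp only [CodeType.q]
      push_cast
      linear_combination Complex.I_sq)
    set c := (1 + ((CodeType.II.q : ℂ) - 1) * Complex.I) / root CodeType.II.q 1 with hc
    have hr := root_mul_root CodeType.II.q 1
    have hr0 := root_ne_zero CodeType.II.q 1 (by decide)
    simp only [CodeType.q, pow_one, Nat.cast_ofNat] at hr hc hr0
    have hc2 : c ^ 2 = Complex.I := by
      rw [hc]
      field_simp
      rw [sq (root 2 1), hr]
      linear_combination Complex.I_sq
    have ho : orderOf c = 2 ^ (2 + 1) := by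
      apply orderOf_eq_prime_pow
      · rw [show 2 ^ 2 = 2 * 2 from rfl, pow_mul, hc2, Complex.I_sq]
        norm_num
      · rw [show 2 ^ (2 + 1) = 2 * 4 from rfl, pow_mul, hc2, Complex.I_pow_four]
    have := orderOf_dvd_of_pow_eq_one h
    rwa [ho] at this
  case III =>
    obtain ⟨ζ, hζ⟩ : ∃ ζ : ℂ, ζ ^ 2 + ζ + 1 = 0 := by
      have h := Complex.isPrimitiveRoot_exp 3 (by norm_num)
      have h1 := h.geom_sum_eq_zero (by norm_num)
      refine ⟨Complex.exp (2 * Real.pi * Complex.I / (3 : ℕ)), Eq.trans ?_ h1⟩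
      rw [Finset.sum_range_succ, Finset.sum_range_succ, Finset.sum_range_one]
      push_cast
      ring
    have h := hC.pow_length_eq_one (ζ := ζ) (by
      simp only [CodeType.weightDivisor]
      linear_combination (ζ - 1) * hζ) (by
      simp only [CodeType.q]
      push_cast
      linear_combination hζ)
    set c := (1 + ((CodeType.III.q : ℂ) - 1) * ζ) / root CodeType.III.q 1 with hc
    have hr := root_mul_root CodeType.III.q 1
    have hr0 := root_ne_zero CodeType.III.q 1 (by decide)
    simp only [CodeType.q, pow_one, Nat.cast_ofNat] at hr hc hr0
    have hc2 : c ^ 2 = -1 := by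
      rw [hc]
      field_simp
      rw [sq (root 3 1), hr]
      linear_combination 4 * hζ
    have ho : orderOf c = 2 ^ (1 + 1) := by
      apply orderOf_eq_prime_pow
      · rw [pow_one, hc2]
        norm_num
      · rw [show 2 ^ (1 + 1) = 2 * 2 from rfl, pow_mul, hc2]
        norm_num
    have := orderOf_dvd_of_pow_eq_one h
    rwa [ho] at this

end Length

/-! ### Characters and relative invariants -/

section Characters

variable {T : CodeType} {m : ℕ}

theorem CodeType.N_pos (T : CodeType) : 0 < T.N := by
  cases T <;> simp [CodeType.N]

theorem CodeType.two_dvd_N (T : CodeType) : 2 ∣ T.N := by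
  cases T <;> decide

theorem isPrimitiveRoot_omega (T : CodeType) : IsPrimitiveRoot (omega T.N) T.N :=
  Complex.isPrimitiveRoot_exp _ T.N_pos.ne'

theorem omega_ne_zero (N : ℕ) : omega N ≠ 0 := Complex.exp_ne_zero _

theorem neg_one_zpow_neg (d : ℕ) : (-1 : ℂ) ^ (-(d : ℤ)) = (-1) ^ d := by
  rw [zpow_neg, zpow_natCast, ← inv_pow, inv_neg, inv_one]

theorem IsChar.ext {d e : ℕ} {χ ψ : G T m →* ℂˣ} (hχ : IsChar T m d e χ) (hψ : IsChar T m d e ψ) :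
    χ = ψ := by
  ext ⟨g, hg⟩
  congr 1
  induction hg using Subgroup.closure_induction with
  | mem g hg =>
    rcases hg with rfl | rfl
    · exact Units.ext (hχ.1.trans hψ.1.symm)
    · exact Units.ext (hχ.2.trans hψ.2.symm)
  | one => exact (map_one χ).trans (map_one ψ).symm
  | mul a b ha hb iha ihb =>
    have h : (⟨a * b, mul_mem ha hb⟩ : G T m) = ⟨a, ha⟩ * ⟨b, hb⟩ := rfl
    exact (congrArg χ h).trans ((map_mul χ _ _).trans
      ((congrArg₂ _ iha ihb).trans ((map_mul ψ _ _).symm.trans (congrArg ψ h.symm))))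
  | inv a ha iha =>
    have h : (⟨a⁻¹, inv_mem ha⟩ : G T m) = ⟨a, ha⟩⁻¹ := rfl
    exact (congrArg χ h).trans ((map_inv χ _).trans
      ((congrArg _ iha).trans ((map_inv ψ _).symm.trans (congrArg ψ h.symm))))

theorem omegaGL_coe (T : CodeType) :
    (omegaGL T : Matrix (Fin 2) (Fin 2) ℂ) = Matrix.scalar (Fin 2) (omega T.N) := rfl

/-- A row vector `(1, c)` with `(c + 1)² = q ^ m` is an eigenvector of the group. -/
theorem vecMul_mem_G {c : ℂ} (hc : (c + 1) ^ 2 = (T.q : ℂ) ^ m) {g : GL (Fin 2) ℂ}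
    (hg : g ∈ G T m) :
    Matrix.vecMul ![1, c] (g : Matrix (Fin 2) (Fin 2) ℂ) =
      Matrix.vecMul ![1, c] (g : Matrix (Fin 2) (Fin 2) ℂ) 0 • ![1, c] := by
  suffices h : ∃ l : ℂ, Matrix.vecMul ![1, c] (g : Matrix (Fin 2) (Fin 2) ℂ) = l • ![1, c] by
    obtain ⟨l, hl⟩ := h
    rw [hl]
    simp
  induction hg using Subgroup.closure_induction with
  | mem g hg =>
    rcases hg with rfl | rfl
    · refine ⟨(1 + c) / root T.q m, ?_⟩
      have hS : (SGL T m : Matrix (Fin 2) (Fin 2) ℂ) = SMat m T.q := rfl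
      rw [hS, SMat]
      ext i
      fin_cases i
      · simp [Matrix.vecMul, dotProduct, Fin.sum_univ_two]
        ring
      · simp [Matrix.vecMul, dotProduct, Fin.sum_univ_two]
        rw [← hc]
        ring
    · refine ⟨omega T.N, ?_⟩
      rw [omegaGL_coe]
      ext i
      fin_cases i <;> simp [Matrix.vecMul, dotProduct, Fin.sum_univ_two, mul_comm]
  | one => exact ⟨1, by simp⟩
  | mul a b _ _ iha ihb =>
    obtain ⟨l, hl⟩ := iha
    obtain ⟨k, hk⟩ := ihb
    refine ⟨l * k, ?_⟩
    rw [Units.val_mul, ← Matrix.vecMul_vecMul, hl, Matrix.smul_vecMul, hk, smul_smul]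
  | inv a _ iha =>
    obtain ⟨l, hl⟩ := iha
    have h1 : ![1, c] = l • Matrix.vecMul ![1, c] (a⁻¹ : GL (Fin 2) ℂ).1 := by
      rw [← Matrix.smul_vecMul, ← hl, Matrix.vecMul_vecMul, ← Units.val_mul, mul_inv_cancel,
        Units.val_one, Matrix.vecMul_one]
    have hl0 : l ≠ 0 := by
      rintro rfl
      have := congrFun h1 0
      simp at this
    refine ⟨l⁻¹, ?_⟩
    conv_rhs => rw [h1, smul_smul, inv_mul_cancel₀ hl0, one_smul]

/-- The eigenvalue of the row vector `(1, c)` as a character. -/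
def eigenChar {c : ℂ} (hc : (c + 1) ^ 2 = (T.q : ℂ) ^ m) : G T m →* ℂˣ :=
  MonoidHom.toHomUnits
    { toFun := fun g => Matrix.vecMul ![1, c] (g.1 : Matrix (Fin 2) (Fin 2) ℂ) 0
      map_one' := by simp
      map_mul' := fun g h => by
        rw [Subgroup.coe_mul, Units.val_mul, ← Matrix.vecMul_vecMul, vecMul_mem_G hc g.2,
          Matrix.smul_vecMul]
        simp }

theorem eigenChar_genS {c : ℂ} (hc : (c + 1) ^ 2 = (T.q : ℂ) ^ m) :
    (eigenChar hc (genS T m) : ℂ) = (c + 1) / root T.q m := by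
  change Matrix.vecMul ![1, c] (SMat m T.q) 0 = _
  simp [SMat, Matrix.vecMul, dotProduct, Fin.sum_univ_two]
  ring

theorem eigenChar_genOmega {c : ℂ} (hc : (c + 1) ^ 2 = (T.q : ℂ) ^ m) :
    (eigenChar hc (genOmega T m) : ℂ) = omega T.N := by
  change Matrix.vecMul ![1, c] (omegaGL T).1 0 = _
  rw [omegaGL_coe]
  simp [Matrix.vecMul, dotProduct, Fin.sum_univ_two]

/-- The row vectors of coefficients of `u` and `v` give eigenvalue characters with values `1` and
`-1` on `S_{m,q}` and `ω_N` on `ω_N I`. Their quotient adjusts the first value alone, and the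
inverse of the first adjusts the second alone. -/
theorem existsUnique_isChar (T : CodeType) (m d e : ℕ) : ∃! χ : G T m →* ℂˣ, IsChar T m d e χ := by
  have hr := root_ne_zero T.q m T.q_pos
  have hrr := root_mul_root T.q m
  have hu : (root T.q m - 1 + 1) ^ 2 = (T.q : ℂ) ^ m := by rw [← hrr]; ring
  have hv : (-(root T.q m) - 1 + 1) ^ 2 = (T.q : ℂ) ^ m := by rw [← hrr]; ring
  refine ⟨((eigenChar hu)⁻¹ * eigenChar hv) ^ d * ((eigenChar hu)⁻¹) ^ e, ⟨?_, ?_⟩,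
    fun ψ hψ => hψ.ext ⟨?_, ?_⟩⟩
  all_goals
    simp only [MonoidHom.mul_apply, MonoidHom.pow_apply, MonoidHom.inv_apply, Units.val_mul,
      Units.val_pow_eq_pow_val, Units.val_inv_eq_inv_val, eigenChar_genS, eigenChar_genOmega]
  any_goals
    rw [neg_one_zpow_neg, sub_add_cancel, sub_add_cancel, neg_div, div_self hr]
    simp
  all_goals
    rw [inv_mul_cancel₀ (omega_ne_zero _), one_pow, one_mul, inv_pow, zpow_neg, zpow_natCast]

/-- Substitution reverses products; this is harmless for relative invariants because `χ` takes
values in a commutative group. -/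
theorem act_mul (g h : GL (Fin 2) ℂ) (P : Poly) : act (g * h) P = act h (act g P) := by
  refine MvPolynomial.funext fun p => ?_
  obtain ⟨x, y, rfl⟩ : ∃ x y, p = ![x, y] := ⟨p 0, p 1, by ext i; fin_cases i <;> rfl⟩
  rw [eval_act, eval_act, eval_act, Units.val_mul]
  simp only [Matrix.mul_apply, Fin.sum_univ_two]
  congr 3 <;> ring_nf

theorem act_one (P : Poly) : act 1 P = P := by
  refine MvPolynomial.funext fun p => ?_
  obtain ⟨x, y, rfl⟩ : ∃ x y, p = ![x, y] := ⟨p 0, p 1, by ext i; fin_cases i <;> rfl⟩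
  rw [eval_act]
  simp

/-- The elements transforming `P` by `χ` form a subgroup, so the two generators suffice. -/
theorem IsChar.mem_relInv {d e : ℕ} {χ : G T m →* ℂˣ} (hχ : IsChar T m d e χ) {P : Poly} :
    P ∈ relInv χ ↔ act (SGL T m) P = (-1 : ℂ) ^ d • P ∧
      act (omegaGL T) P = (omega T.N ^ e)⁻¹ • P := by
  have h1 := hχ.1
  have h2 := hχ.2
  rw [neg_one_zpow_neg] at h1
  rw [zpow_neg, zpow_natCast] at h2
  rw [← h1, ← h2]
  refine ⟨fun h => ⟨h (genS T m), h (genOmega T m)⟩, fun h => ?_⟩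
  rintro ⟨g, hg⟩
  induction hg using Subgroup.closure_induction with
  | mem g hg =>
    rcases hg with rfl | rfl
    · exact h.1
    · exact h.2
  | one =>
    have h3 : χ ⟨1, one_mem _⟩ = 1 := map_one χ
    rw [h3, act_one, Units.val_one, one_smul]
  | mul a b ha hb iha ihb =>
    have h3 : χ ⟨a * b, mul_mem ha hb⟩ = χ ⟨a, ha⟩ * χ ⟨b, hb⟩ := map_mul χ ⟨a, ha⟩ ⟨b, hb⟩
    dsimp only at iha ihb ⊢
    rw [h3, act_mul, iha, map_smul, ihb, smul_smul, Units.val_mul]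
  | inv a ha iha =>
    have h3 : χ ⟨a⁻¹, inv_mem ha⟩ = (χ ⟨a, ha⟩)⁻¹ := map_inv χ ⟨a, ha⟩
    dsimp only at iha ⊢
    have h4 := act_mul a a⁻¹ P
    rw [mul_inv_cancel, act_one, iha, map_smul] at h4
    rw [h3, Units.val_inv_eq_inv_val]
    conv_rhs => rw [h4, smul_smul, inv_mul_cancel₀ (Units.ne_zero _), one_smul]

theorem act_omegaGL_X (T : CodeType) (i : Fin 2) :
    act (omegaGL T) (X i) = C (omega T.N) * X i := by
  unfold act
  rw [aeval_X, omegaGL_coe]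
  fin_cases i <;> simp [Fin.sum_univ_two]

theorem act_C (g : GL (Fin 2) ℂ) (c : ℂ) : act g (C c) = C c :=
  (act g).commutes c

end Characters

/-! ### Covariance of the harmonic enumerators -/

section EnumeratorInvariance

variable {F : Type*} [Field F] {n d m : ℕ} {T : CodeType}

/-- Every monomial of `Z` has degree `n - 2d`, and `N ∣ n`. -/
theorem IsTypeCode.act_omegaGL_Z {C : Submodule F (Fin n → F)} (hC : IsTypeCode T C)
    (f : Sub n d → ℝ) :
    act (omegaGL T) (Z C m f) = (omega T.N ^ (2 * d))⁻¹ • Z C m f := by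
  unfold Z
  rw [map_sum, Finset.smul_sum]
  refine Finset.sum_congr rfl fun S hS => ?_
  obtain ⟨h1, h2⟩ := (Finset.mem_filter.mp hS).2
  obtain ⟨k, hk⟩ := hC.N_dvd
  have h3 : omega T.N ^ (n - S.card - d) * omega T.N ^ (S.card - d) =
      (omega T.N ^ (2 * d))⁻¹ := by
    apply eq_inv_of_mul_eq_one_left
    rw [← pow_add, ← pow_add,
      show n - S.card - d + (S.card - d) + 2 * d = T.N * k by omega, pow_mul,
      (isPrimitiveRoot_omega T).pow_eq_one, one_pow]
  rw [map_mul, map_mul, map_pow, map_pow, act_omegaGL_X, act_omegaGL_X, act_C, ← h3, smul_eq_C_mul,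
    MvPolynomial.C.map_mul (_ ^ _), MvPolynomial.C.map_pow, MvPolynomial.C.map_pow]
  ring

theorem IsTypeCode.Z_mem_relInv {C : Submodule F (Fin n → F)} (hC : IsTypeCode T C)
    {f : Sub n d → ℝ} (hf : f ∈ Harm n d) {χ : G T m →* ℂˣ} (hχ : IsChar T m d (2 * d) χ) :
    Z C m f ∈ relInv χ :=
  hχ.mem_relInv.mpr ⟨hC.act_SGL_Z m hf, hC.act_omegaGL_Z f⟩

/-- A nonzero `Z` has the `ω_N I`-eigenvalue `ω_N ^ (-2d)`, which equals `ω_N ^ (-d)` exactly when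
`N ∣ d`. -/
theorem IsTypeCode.Z_mem_relInv_iff {C : Submodule F (Fin n → F)} (hC : IsTypeCode T C)
    {f : Sub n d → ℝ} (hf : f ∈ Harm n d) {χ : G T m →* ℂˣ} (hχ : IsChar T m d d χ) :
    Z C m f ∈ relInv χ ↔ T.N ∣ d ∨ Z C m f = 0 := by
  rw [hχ.mem_relInv, hC.act_omegaGL_Z, and_iff_right (hC.act_SGL_Z m hf), ← sub_eq_zero, ← sub_smul,
    smul_eq_zero, sub_eq_zero, inv_inj, two_mul, pow_add, ← (isPrimitiveRoot_omega T).pow_eq_one_iff_dvd,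
    mul_eq_left₀ (pow_ne_zero _ (omega_ne_zero _))]

end EnumeratorInvariance

/-! ### Relative invariants in the coordinates `u`, `v` -/

section Coordinates

variable (T : CodeType) (m : ℕ)

/-- The change of coordinates `x ↦ u`, `y ↦ v`. -/
def toUV : Poly →ₐ[ℂ] Poly := aeval ![u T m, v T m]

theorem toUV_X_zero : toUV T m (X 0) = u T m := by simp [toUV]

theorem toUV_X_one : toUV T m (X 1) = v T m := by simp [toUV]

/-- The inverse of `toUV`. -/
def ofUV : Poly →ₐ[ℂ] Poly :=
  aeval ![C (1 / (2 * root T.q m)) * (C (root T.q m + 1) * X 0 + C (root T.q m - 1) * X 1),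
    C (1 / (2 * root T.q m)) * (X 0 - X 1)]

theorem ofUV_X_zero : ofUV T m (X 0) =
    C (1 / (2 * root T.q m)) * (C (root T.q m + 1) * X 0 + C (root T.q m - 1) * X 1) := by
  simp [ofUV]

theorem ofUV_X_one : ofUV T m (X 1) = C (1 / (2 * root T.q m)) * (X 0 - X 1) := by simp [ofUV]

theorem C_inv_two_root : (C (1 / (2 * root T.q m)) * (2 * C (root T.q m)) : Poly) = 1 := by
  have hr := root_ne_zero T.q m T.q_pos
  rw [show (2 : Poly) = C 2 from rfl, ← MvPolynomial.C.map_mul, ← MvPolynomial.C.map_mul,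
    one_div, inv_mul_cancel₀ (mul_ne_zero two_ne_zero hr), MvPolynomial.C_1]

theorem toUV_comp_ofUV : (toUV T m).comp (ofUV T m) = AlgHom.id ℂ Poly := by
  have h := C_inv_two_root T m
  have hC : ∀ c, toUV T m (C c) = C c := (toUV T m).commutes
  ext1 i
  fin_cases i
  · change toUV T m (ofUV T m (X 0)) = X 0
    rw [ofUV_X_zero]
    simp only [map_mul, map_add, hC, toUV_X_zero, toUV_X_one]
    simp only [u, v, C_add, C_sub, C_1]
    linear_combination (X 0) * h
  · change toUV T m (ofUV T m (X 1)) = X 1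
    rw [ofUV_X_one]
    simp only [map_mul, map_sub, hC, toUV_X_zero, toUV_X_one]
    simp only [u, v, C_add, C_sub, C_1]
    linear_combination (X 1) * h

theorem ofUV_comp_toUV : (ofUV T m).comp (toUV T m) = AlgHom.id ℂ Poly := by
  have h := C_inv_two_root T m
  have hC : ∀ c, ofUV T m (C c) = C c := (ofUV T m).commutes
  ext1 i
  fin_cases i
  · change ofUV T m (toUV T m (X 0)) = X 0
    rw [toUV_X_zero, u]
    simp only [map_mul, map_add, hC, ofUV_X_zero, ofUV_X_one]
    simp only [C_sub, C_1]
    linear_combination (X 0) * h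
  · change ofUV T m (toUV T m (X 1)) = X 1
    rw [toUV_X_one, v]
    simp only [map_mul, map_sub, hC, ofUV_X_zero, ofUV_X_one]
    simp only [C_add, C_1]
    linear_combination (X 1) * h

theorem toUV_injective : Function.Injective (toUV T m) :=
  Function.LeftInverse.injective (g := ofUV T m) (AlgHom.congr_fun (ofUV_comp_toUV T m))

theorem toUV_surjective : Function.Surjective (toUV T m) :=
  Function.RightInverse.surjective (g := ofUV T m) (AlgHom.congr_fun (toUV_comp_ofUV T m))

/-- Turns questions about `ℂ[u ^ N, v ^ N]` into questions about `expand`, whose coefficients are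
explicit. -/
theorem aeval_pow_eq (p : Poly) :
    aeval ![u T m ^ T.N, v T m ^ T.N] p = toUV T m (expand T.N p) := by
  rw [toUV, aeval_expand]
  congr 2
  ext1 i
  fin_cases i <;> rfl

theorem algebraicIndependent_pow : AlgebraicIndependent ℂ ![u T m ^ T.N, v T m ^ T.N] := by
  intro p q h
  rw [aeval_pow_eq, aeval_pow_eq] at h
  exact expand_injective T.N_pos (toUV_injective T m h)

theorem mem_R {a : Poly} : a ∈ R T m ↔ ∃ p, toUV T m (expand T.N p) = a := by
  have h : R T m = (aeval ![u T m ^ T.N, v T m ^ T.N] : Poly →ₐ[ℂ] Poly).range := by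
    rw [← Algebra.adjoin_range_eq_range_aeval, Matrix.range_cons, Matrix.range_cons,
      Matrix.range_empty, Set.union_empty]
    rfl
  rw [h, AlgHom.mem_range]
  simp only [aeval_pow_eq]

/-- The substitution `x ↦ s x`, `y ↦ t y`. -/
def scaleVars (s t : ℂ) : Poly →ₐ[ℂ] Poly := aeval ![C s * X 0, C t * X 1]

theorem coeff_scaleVars (s t : ℂ) (p : Poly) (k : Fin 2 →₀ ℕ) :
    coeff k (scaleVars s t p) = s ^ k 0 * t ^ k 1 * coeff k p := by
  induction p using MvPolynomial.induction_on' with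
  | monomial l c =>
    have h : scaleVars s t (monomial l c) = C (s ^ l 0 * t ^ l 1) * monomial l c := by
      have h1 : (monomial l c : Poly) = C c * (X 0 ^ l 0 * X 1 ^ l 1) := by
        rw [monomial_eq, Finsupp.prod_fintype _ _ (fun i => pow_zero _), Fin.prod_univ_two]
      rw [h1, map_mul, map_mul, map_pow, map_pow, show scaleVars s t (C c) = C c from
        (scaleVars s t).commutes c]
      simp only [scaleVars, aeval_X, Matrix.cons_val_zero, Matrix.cons_val_one, C_mul, C_pow]
      ring
    rw [h, coeff_C_mul, coeff_monomial]
    split_ifs with h1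
    · rw [h1]
    · simp
  | add p q hp hq => rw [map_add, coeff_add, coeff_add, hp, hq, mul_add]

theorem act_SGL_u : act (SGL T m) (u T m) = u T m := by
  have hr := root_ne_zero T.q m T.q_pos
  have hrr := root_mul_root T.q m
  have hS : (SGL T m : Matrix (Fin 2) (Fin 2) ℂ) = SMat m T.q := rfl
  refine MvPolynomial.funext fun p => ?_
  obtain ⟨x, y, rfl⟩ : ∃ x y, p = ![x, y] := ⟨p 0, p 1, by ext i; fin_cases i <;> rfl⟩
  rw [eval_act, hS]
  simp [SMat, u]
  rw [← hrr]
  field_simp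
  ring

theorem act_SGL_v : act (SGL T m) (v T m) = -v T m := by
  have hr := root_ne_zero T.q m T.q_pos
  have hrr := root_mul_root T.q m
  have hS : (SGL T m : Matrix (Fin 2) (Fin 2) ℂ) = SMat m T.q := rfl
  refine MvPolynomial.funext fun p => ?_
  obtain ⟨x, y, rfl⟩ : ∃ x y, p = ![x, y] := ⟨p 0, p 1, by ext i; fin_cases i <;> rfl⟩
  rw [eval_act, hS]
  simp [SMat, v]
  rw [← hrr]
  field_simp
  ring

theorem act_omegaGL_u : act (omegaGL T) (u T m) = C (omega T.N) * u T m := by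
  rw [u, map_add, map_mul, act_C, act_omegaGL_X, act_omegaGL_X]
  ring

theorem act_omegaGL_v : act (omegaGL T) (v T m) = C (omega T.N) * v T m := by
  rw [v, map_sub, map_mul, act_C, act_omegaGL_X, act_omegaGL_X]
  ring

theorem act_SGL_toUV (p : Poly) :
    act (SGL T m) (toUV T m p) = toUV T m (scaleVars 1 (-1) p) := by
  have h : (act (SGL T m)).comp (toUV T m) = (toUV T m).comp (scaleVars 1 (-1)) := by
    ext1 i
    fin_cases i
    · simp [scaleVars, toUV, act_SGL_u]
    · simp [scaleVars, toUV, act_SGL_v]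
  exact AlgHom.congr_fun h p

theorem act_omegaGL_toUV (p : Poly) :
    act (omegaGL T) (toUV T m p) = toUV T m (scaleVars (omega T.N) (omega T.N) p) := by
  have hC : ∀ c, toUV T m (C c) = C c := (toUV T m).commutes
  have h : (act (omegaGL T)).comp (toUV T m) =
      (toUV T m).comp (scaleVars (omega T.N) (omega T.N)) := by
    ext1 i
    fin_cases i
    · change act (omegaGL T) (toUV T m (X 0)) = toUV T m (scaleVars _ _ (X 0))
      rw [toUV_X_zero, act_omegaGL_u]
      simp [scaleVars, hC, toUV_X_zero]
    · change act (omegaGL T) (toUV T m (X 1)) = toUV T m (scaleVars _ _ (X 1))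
      rw [toUV_X_one, act_omegaGL_v]
      simp [scaleVars, hC, toUV_X_one]
  exact AlgHom.congr_fun h p

/-! ### Monomial bases of the spaces of relative invariants -/

variable {T m}

theorem neg_one_pow_eq_iff (a b : ℕ) : (-1 : ℂ) ^ a = (-1) ^ b ↔ a % 2 = b % 2 := by
  have h : ∀ k : ℕ, (-1 : ℂ) ^ k = if k % 2 = 0 then 1 else -1 := by
    intro k
    split_ifs with hk
    · exact (Nat.even_iff.mpr hk).neg_one_pow
    · exact (Nat.odd_iff.mpr (by omega)).neg_one_pow
  rw [h, h]
  split_ifs with h1 h2 h2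
  · simp [h1, h2]
  · have : ¬ a % 2 = b % 2 := by omega
    norm_num [this]
  · have : ¬ a % 2 = b % 2 := by omega
    norm_num [this]
  · have : a % 2 = b % 2 := by omega
    simp [this]

/-- The relative invariants are spanned by the monomials `u ^ a v ^ b` with `b ≡ d` mod `2` and
`a + b + e ≡ 0` mod `N`. -/
theorem IsChar.toUV_mem_relInv {d e : ℕ} {χ : G T m →* ℂˣ} (hχ : IsChar T m d e χ) {p : Poly} :
    toUV T m p ∈ relInv χ ↔
      ∀ k, coeff k p ≠ 0 → k 1 % 2 = d % 2 ∧ T.N ∣ k 0 + k 1 + e := by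
  rw [hχ.mem_relInv, act_SGL_toUV, act_omegaGL_toUV, ← map_smul, ← map_smul,
    (toUV_injective T m).eq_iff, (toUV_injective T m).eq_iff, MvPolynomial.ext_iff,
    MvPolynomial.ext_iff, ← forall_and]
  refine forall_congr' fun k => ?_
  simp only [coeff_scaleVars, coeff_smul, smul_eq_mul]
  by_cases h : coeff k p = 0
  · simp [h]
  rw [mul_left_inj' h, mul_left_inj' h, one_pow, one_mul, neg_one_pow_eq_iff, ← pow_add,
    ← mul_eq_one_iff_eq_inv₀ (pow_ne_zero _ (omega_ne_zero _)), ← pow_add,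
    (isPrimitiveRoot_omega T).pow_eq_one_iff_dvd]
  simp [h]

/-- The exponents `κ i` are, without repetition, the pairs of residues `(a, b)` modulo `N` with
`b ≡ d` mod `2` and `a + b + e ≡ 0` mod `N`. -/
def IsExponentSystem (N d e : ℕ) {r : ℕ} (κ : Fin r → ℕ × ℕ) : Prop :=
  (∀ i, (κ i).1 < N ∧ (κ i).2 < N ∧ (κ i).2 % 2 = d % 2 ∧ ((κ i).1 + (κ i).2 + e) % N = 0) ∧
    (∀ i j, κ i = κ j → i = j) ∧
      ∀ a < N, ∀ b < N, b % 2 = d % 2 → (a + b + e) % N = 0 → ∃ i, κ i = (a, b)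

instance (N d e : ℕ) {r : ℕ} (κ : Fin r → ℕ × ℕ) : Decidable (IsExponentSystem N d e κ) := by
  unfold IsExponentSystem
  infer_instance

/-- Allows the check by `decide` at fixed numerals to serve a whole residue class of `d`. -/
theorem IsExponentSystem.congr {N d e d' e' r : ℕ} {κ : Fin r → ℕ × ℕ}
    (h : IsExponentSystem N d e κ) (hd : d % 2 = d' % 2) (he : e % N = e' % N) :
    IsExponentSystem N d' e' κ := by
  have h1 : ∀ x, (x + e') % N = (x + e) % N := fun x => (Nat.ModEq.add_left x he).symm
  unfold IsExponentSystem
  simp only [h1, ← hd]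
  exact h

/-- The exponent `(a, b)` as a finitely supported function. -/
def expPair (κ : ℕ × ℕ) : Fin 2 →₀ ℕ := Finsupp.equivFunOnFinite.symm ![κ.1, κ.2]

theorem expPair_zero (κ : ℕ × ℕ) : expPair κ 0 = κ.1 := rfl

theorem expPair_one (κ : ℕ × ℕ) : expPair κ 1 = κ.2 := rfl

theorem toUV_monomial (κ : ℕ × ℕ) :
    toUV T m (monomial (expPair κ) 1) = u T m ^ κ.1 * v T m ^ κ.2 := by
  rw [monomial_eq, Finsupp.prod_fintype _ _ (fun i => pow_zero _), Fin.prod_univ_two, C_1, one_mul,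
    map_mul, map_pow, map_pow, toUV_X_zero, toUV_X_one, expPair_zero, expPair_one]

/-- Division of both exponents by `N` splits each admissible monomial uniquely as an element of `R`
times one `u ^ a v ^ b` from the list; uniqueness of remainders gives independence. -/
theorem isFreeOn_relInv {d e : ℕ} {χ : G T m →* ℂˣ} (hχ : IsChar T m d e χ) {r : ℕ}
    {κ : Fin r → ℕ × ℕ} (hκ : IsExponentSystem T.N d e κ) :
    IsFreeOn (R T m) (relInv χ) fun i => u T m ^ (κ i).1 * v T m ^ (κ i).2 := by
  obtain ⟨hκ1, hκ2, hκ3⟩ := hκ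
  have hN := T.N_pos
  simp only [← toUV_monomial]
  constructor
  · rw [Fintype.linearIndependent_iff]
    intro g hg j
    choose p hp using fun i => (mem_R T m).mp (g i).2
    have h1 : ∑ i, expand T.N (p i) * monomial (expPair (κ i)) 1 = 0 := by
      apply toUV_injective T m
      rw [map_zero, map_sum, ← hg]
      refine Finset.sum_congr rfl fun i _ => ?_
      rw [map_mul, hp, Subalgebra.smul_def, smul_eq_mul]
    suffices h2 : p j = 0 by
      apply Subtype.ext
      rw [← hp j, h2, map_zero, map_zero]
      rfl
    ext k
    -- The exponent `N k + κ j` isolates the coefficient of `k` in `p j`: any other summand reaching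
    -- it would force `κ i` and `κ j` to agree modulo `N`, hence to be equal.
    have h3 := congrArg (coeff (T.N • k + expPair (κ j))) h1
    rw [coeff_sum, Finset.sum_eq_single j] at h3
    · rwa [coeff_mul_monomial, mul_one, coeff_expand_smul _ hN.ne'] at h3
    · intro i _ hij
      rw [coeff_mul_monomial', mul_one]
      split_ifs with hle
      · by_contra hne
        apply hij
        apply hκ2
        have h0 : ∀ s, (T.N • k + expPair (κ j) - expPair (κ i)) s % T.N = 0 := by
          intro s
          by_contra hs
          exact hne (coeff_expand_of_not_dvd _ (i := s) fun h => hs (Nat.mod_eq_zero_of_dvd h))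
        have h5 : ∀ s, expPair (κ j) s < T.N → expPair (κ i) s < T.N →
            expPair (κ i) s = expPair (κ j) s := by
          intro s hj hi
          have h6 := hle s
          obtain ⟨t, ht⟩ := Nat.dvd_of_mod_eq_zero (h0 s)
          simp only [Finsupp.coe_tsub, Finsupp.coe_add, Finsupp.coe_smul, Pi.sub_apply,
            Pi.add_apply, Pi.smul_apply, smul_eq_mul] at h6 ht
          have h7 : T.N * k s + expPair (κ j) s = T.N * t + expPair (κ i) s := by omega
          have h8 := congrArg (· % T.N) h7
          simp only [Nat.mul_add_mod, Nat.mod_eq_of_lt hj, Nat.mod_eq_of_lt hi] at h8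
          exact h8.symm
        exact Prod.ext (h5 0 (hκ1 j).1 (hκ1 i).1) (h5 1 (hκ1 j).2.1 (hκ1 i).2.1)
      · rfl
    · simp
  · ext P
    obtain ⟨p, rfl⟩ := toUV_surjective T m P
    rw [Submodule.restrictScalars_mem]
    constructor
    · intro h
      generalize toUV T m p = Q at h
      induction h using Submodule.span_induction with
      | mem x hx =>
        obtain ⟨i, rfl⟩ := hx
        refine hχ.toUV_mem_relInv.mpr fun k hk => ?_
        have h1 : expPair (κ i) = k := by
          by_contra h
          exact hk (by rw [coeff_monomial, if_neg h])
        rw [← h1]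
        exact ⟨(hκ1 i).2.2.1, Nat.dvd_of_mod_eq_zero (hκ1 i).2.2.2⟩
      | zero => exact zero_mem _
      | add x y _ _ hx hy => exact add_mem hx hy
      | smul a x _ hx =>
        obtain ⟨q, hq⟩ := (mem_R T m).mp a.2
        -- An element of `R` is fixed as soon as `u ^ N` and `v ^ N` are; for the two generators
        -- this holds because `N` is even and `ω_N ^ N = 1`.
        have hinv : ∀ g : GL (Fin 2) ℂ, act g (u T m ^ T.N) = u T m ^ T.N →
            act g (v T m ^ T.N) = v T m ^ T.N → act g a.1 = a.1 := by
          intro g h1 h2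
          have h3 : R T m ≤ AlgHom.equalizer (act g) (AlgHom.id ℂ Poly) := by
            refine Algebra.adjoin_le ?_
            rintro _ (rfl | rfl)
            · exact h1
            · exact h2
          exact h3 a.2
        have hω := (isPrimitiveRoot_omega T).pow_eq_one
        have h1 := hinv (SGL T m) (by rw [map_pow, act_SGL_u]) (by
          rw [map_pow, act_SGL_v, (even_iff_two_dvd.mpr T.two_dvd_N).neg_pow])
        have h2 := hinv (omegaGL T)
          (by rw [map_pow, act_omegaGL_u, mul_pow, ← C_pow, hω, C_1, one_mul])
          (by rw [map_pow, act_omegaGL_v, mul_pow, ← C_pow, hω, C_1, one_mul])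
        rw [hχ.mem_relInv] at hx ⊢
        rw [Subalgebra.smul_def, smul_eq_mul, map_mul, map_mul, h1, h2, hx.1, hx.2, mul_smul_comm,
          mul_smul_comm]
        exact ⟨rfl, rfl⟩
    · intro h
      rw [hχ.toUV_mem_relInv] at h
      rw [p.as_sum, map_sum]
      refine Submodule.sum_mem _ fun k hk => ?_
      obtain ⟨h1, h2⟩ := h k (mem_support_iff.mp hk)
      have hN2 := T.two_dvd_N
      -- Reduction modulo `N` preserves the parity condition because `2 ∣ N`.
      obtain ⟨i, hi⟩ := hκ3 (k 0 % T.N) (Nat.mod_lt _ hN) (k 1 % T.N) (Nat.mod_lt _ hN)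
        (by rw [Nat.mod_mod_of_dvd _ hN2, h1]) (by
          have h3 : (k 0 % T.N + k 1 % T.N + e) ≡ k 0 + k 1 + e [MOD T.N] :=
            ((Nat.mod_modEq _ _).add (Nat.mod_modEq _ _)).add_right e
          exact Eq.trans h3 (Nat.mod_eq_zero_of_dvd h2))
      have h3 : k = T.N • expPair (k 0 / T.N, k 1 / T.N) + expPair (κ i) := by
        ext s
        rw [hi]
        fin_cases s
        · exact (Nat.div_add_mod (k 0) T.N).symm
        · exact (Nat.div_add_mod (k 1) T.N).symm
      have h4 : toUV T m (monomial k (coeff k p)) =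
          (⟨_, (mem_R T m).mpr ⟨monomial (expPair (k 0 / T.N, k 1 / T.N)) (coeff k p), rfl⟩⟩ : R T m) •
            toUV T m (monomial (expPair (κ i)) 1) := by
        rw [Subalgebra.smul_def, smul_eq_mul, ← map_mul, expand_monomial, monomial_mul, mul_one,
          ← h3]
      rw [h4]
      exact Submodule.smul_mem _ _ (Submodule.subset_span ⟨i, rfl⟩)

theorem isFreeOn_relInv_of_eq {d e d' e' : ℕ} {χ : G T m →* ℂˣ} (hχ : IsChar T m d e χ) {r : ℕ}
    {Q : Fin r → Poly} (κ : Fin r → ℕ × ℕ) (hκ : IsExponentSystem T.N d' e' κ)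
    (hd : d' % 2 = d % 2) (he : e' % T.N = e % T.N)
    (hQ : Q = fun i => u T m ^ (κ i).1 * v T m ^ (κ i).2) :
    IsFreeOn (R T m) (relInv χ) Q := by
  rw [hQ]
  exact isFreeOn_relInv hχ (hκ.congr hd he)

end Coordinates

end HarmonicCodes

end

theorem theorem5p2 (m d : ℕ) (hm : 1 ≤ m) :
    -- the characters are well defined
    (∀ (T : CodeType) (e : ℕ), ∃! χ : G T m →* ℂˣ, IsChar T m d e χ) ∧
    -- the harmonic weight enumerators of self-dual codes are relative invariants
    (∀ (T : CodeType) (F : Type*) [Field F] (n : ℕ) (C : Submodule F (Fin n → F)),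
      IsTypeCode T C → ∀ f ∈ Harm n d,
        W C m f = (MvPolynomial.X 0 * MvPolynomial.X 1) ^ d * Z C m f ∧
        (∀ χ : G T m →* ℂˣ, IsChar T m d (2 * d) χ → Z C m f ∈ relInv χ) ∧
        (∀ χ : G T m →* ℂˣ, IsChar T m d d χ →
          (Z C m f ∈ relInv χ ↔ T.N ∣ d ∨ Z C m f = 0))) ∧
    -- `ℂ[P₁, P₂]` is a polynomial ring
    (∀ T : CodeType, AlgebraicIndependent ℂ ![u T m ^ T.N, v T m ^ T.N]) ∧
    -- the spaces for the character with `χ(S) = (-1)^{-d}`, `χ(ω I) = ω^{-d}`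
    (∀ χ : G .I m →* ℂˣ, IsChar .I m d d χ →
        (d % 2 = 0 → IsFreeOn (R .I m) (relInv χ) ![1]) ∧
        (d % 2 = 1 → IsFreeOn (R .I m) (relInv χ) ![v .I m])) ∧
    (∀ χ : G .II m →* ℂˣ, IsChar .II m d d χ →
        (d % 8 = 0 → IsFreeOn (R .II m) (relInv χ)
          ![1, u .II m ^ 6 * v .II m ^ 2,
            u .II m ^ 4 * v .II m ^ 4, u .II m ^ 2 * v .II m ^ 6]) ∧
        (d % 8 = 1 → IsFreeOn (R .II m) (relInv χ)
          ![u .II m ^ 6 * v .II m, u .II m ^ 4 * v .II m ^ 3,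
            u .II m ^ 2 * v .II m ^ 5, v .II m ^ 7]) ∧
        (d % 8 = 2 → IsFreeOn (R .II m) (relInv χ)
          ![u .II m ^ 6, u .II m ^ 4 * v .II m ^ 2,
            u .II m ^ 2 * v .II m ^ 4, v .II m ^ 6]) ∧
        (d % 8 = 3 → IsFreeOn (R .II m) (relInv χ)
          ![u .II m ^ 4 * v .II m, u .II m ^ 2 * v .II m ^ 3,
            v .II m ^ 5, u .II m ^ 6 * v .II m ^ 7]) ∧
        (d % 8 = 4 → IsFreeOn (R .II m) (relInv χ)
          ![u .II m ^ 4, u .II m ^ 2 * v .II m ^ 2,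
            v .II m ^ 4, u .II m ^ 6 * v .II m ^ 6]) ∧
        (d % 8 = 5 → IsFreeOn (R .II m) (relInv χ)
          ![u .II m ^ 2 * v .II m, v .II m ^ 3,
            u .II m ^ 6 * v .II m ^ 5, u .II m ^ 4 * v .II m ^ 7]) ∧
        (d % 8 = 6 → IsFreeOn (R .II m) (relInv χ)
          ![u .II m ^ 2, v .II m ^ 2,
            u .II m ^ 6 * v .II m ^ 4, u .II m ^ 4 * v .II m ^ 6]) ∧
        (d % 8 = 7 → IsFreeOn (R .II m) (relInv χ)
          ![v .II m, u .II m ^ 6 * v .II m ^ 3,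
            u .II m ^ 4 * v .II m ^ 5, u .II m ^ 2 * v .II m ^ 7])) ∧
    (∀ χ : G .III m →* ℂˣ, IsChar .III m d d χ →
        (d % 4 = 0 → IsFreeOn (R .III m) (relInv χ) ![1, u .III m ^ 2 * v .III m ^ 2]) ∧
        (d % 4 = 1 → IsFreeOn (R .III m) (relInv χ) ![u .III m ^ 2 * v .III m, v .III m ^ 3]) ∧
        (d % 4 = 2 → IsFreeOn (R .III m) (relInv χ) ![u .III m ^ 2, v .III m ^ 2]) ∧
        (d % 4 = 3 → IsFreeOn (R .III m) (relInv χ) ![v .III m, u .III m ^ 2 * v .III m ^ 3])) ∧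
    (∀ χ : G .IV m →* ℂˣ, IsChar .IV m d d χ →
        (d % 2 = 0 → IsFreeOn (R .IV m) (relInv χ) ![1]) ∧
        (d % 2 = 1 → IsFreeOn (R .IV m) (relInv χ) ![v .IV m])) ∧
    -- the spaces for the character with `χ(S) = (-1)^{-d}`, `χ(ω I) = ω^{-2d}`
    (∀ χ : G .I m →* ℂˣ, IsChar .I m d (2 * d) χ →
        (d % 2 = 0 → IsFreeOn (R .I m) (relInv χ) ![1]) ∧
        (d % 2 = 1 → IsFreeOn (R .I m) (relInv χ) ![u .I m * v .I m])) ∧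
    (∀ χ : G .II m →* ℂˣ, IsChar .II m d (2 * d) χ →
        (d % 4 = 0 → IsFreeOn (R .II m) (relInv χ)
          ![1, u .II m ^ 6 * v .II m ^ 2,
            u .II m ^ 4 * v .II m ^ 4, u .II m ^ 2 * v .II m ^ 6]) ∧
        (d % 4 = 1 → IsFreeOn (R .II m) (relInv χ)
          ![u .II m ^ 5 * v .II m, u .II m ^ 3 * v .II m ^ 3,
            u .II m * v .II m ^ 5, u .II m ^ 7 * v .II m ^ 7]) ∧
        (d % 4 = 2 → IsFreeOn (R .II m) (relInv χ)
          ![u .II m ^ 4, u .II m ^ 2 * v .II m ^ 2,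
            v .II m ^ 4, u .II m ^ 6 * v .II m ^ 6]) ∧
        (d % 4 = 3 → IsFreeOn (R .II m) (relInv χ)
          ![u .II m * v .II m, u .II m ^ 7 * v .II m ^ 3,
            u .II m ^ 5 * v .II m ^ 5, u .II m ^ 3 * v .II m ^ 7])) ∧
    (∀ χ : G .III m →* ℂˣ, IsChar .III m d (2 * d) χ →
        (d % 2 = 0 → IsFreeOn (R .III m) (relInv χ) ![1, u .III m ^ 2 * v .III m ^ 2]) ∧
        (d % 2 = 1 → IsFreeOn (R .III m) (relInv χ)
          ![u .III m * v .III m, u .III m ^ 3 * v .III m ^ 3])) ∧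
    (∀ χ : G .IV m →* ℂˣ, IsChar .IV m d (2 * d) χ →
        (d % 2 = 0 → IsFreeOn (R .IV m) (relInv χ) ![1]) ∧
        (d % 2 = 1 → IsFreeOn (R .IV m) (relInv χ) ![u .IV m * v .IV m])) := by
  refine ⟨fun T e => existsUnique_isChar T m d e, fun T F _ n C hC f hf =>
      ⟨W_eq hf C m, fun χ hχ => hC.Z_mem_relInv hf hχ, fun χ hχ => hC.Z_mem_relInv_iff hf hχ⟩,
    fun T => algebraicIndependent_pow T m, fun χ hχ => ⟨?_, ?_⟩,
    fun χ hχ => ⟨?_, ?_, ?_, ?_, ?_, ?_, ?_, ?_⟩, fun χ hχ => ⟨?_, ?_, ?_, ?_⟩,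
    fun χ hχ => ⟨?_, ?_⟩, fun χ hχ => ⟨?_, ?_⟩, fun χ hχ => ⟨?_, ?_, ?_, ?_⟩,
    fun χ hχ => ⟨?_, ?_⟩, fun χ hχ => ⟨?_, ?_⟩⟩ <;> intro hd
  -- In every row the list holds the exponents `(a, b)` of the stated generators, and `d'`, `e'` are
  -- numerals representing the parity of `d` and the residue modulo `N` of the exponent `d` or `2d`.
  · exact isFreeOn_relInv_of_eq hχ ![(0, 0)] (d' := 0) (e' := 0)
      (by decide) (by omega) (by simp only [CodeType.N]; omega) (by ext1 i; fin_cases i <;> simp)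
  · exact isFreeOn_relInv_of_eq hχ ![(0, 1)] (d' := 1) (e' := 1)
      (by decide) (by omega) (by simp only [CodeType.N]; omega) (by ext1 i; fin_cases i <;> simp)
  · exact isFreeOn_relInv_of_eq hχ ![(0, 0), (6, 2), (4, 4), (2, 6)] (d' := 0) (e' := 0)
      (by decide) (by omega) (by simp only [CodeType.N]; omega) (by ext1 i; fin_cases i <;> simp)
  · exact isFreeOn_relInv_of_eq hχ ![(6, 1), (4, 3), (2, 5), (0, 7)] (d' := 1) (e' := 1)
      (by decide) (by omega) (by simp only [CodeType.N]; omega) (by ext1 i; fin_cases i <;> simp)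
  · exact isFreeOn_relInv_of_eq hχ ![(6, 0), (4, 2), (2, 4), (0, 6)] (d' := 2) (e' := 2)
      (by decide) (by omega) (by simp only [CodeType.N]; omega) (by ext1 i; fin_cases i <;> simp)
  · exact isFreeOn_relInv_of_eq hχ ![(4, 1), (2, 3), (0, 5), (6, 7)] (d' := 3) (e' := 3)
      (by decide) (by omega) (by simp only [CodeType.N]; omega) (by ext1 i; fin_cases i <;> simp)
  · exact isFreeOn_relInv_of_eq hχ ![(4, 0), (2, 2), (0, 4), (6, 6)] (d' := 4) (e' := 4)
      (by decide) (by omega) (by simp only [CodeType.N]; omega) (by ext1 i; fin_cases i <;> simp)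
  · exact isFreeOn_relInv_of_eq hχ ![(2, 1), (0, 3), (6, 5), (4, 7)] (d' := 5) (e' := 5)
      (by decide) (by omega) (by simp only [CodeType.N]; omega) (by ext1 i; fin_cases i <;> simp)
  · exact isFreeOn_relInv_of_eq hχ ![(2, 0), (0, 2), (6, 4), (4, 6)] (d' := 6) (e' := 6)
      (by decide) (by omega) (by simp only [CodeType.N]; omega) (by ext1 i; fin_cases i <;> simp)
  · exact isFreeOn_relInv_of_eq hχ ![(0, 1), (6, 3), (4, 5), (2, 7)] (d' := 7) (e' := 7)
      (by decide) (by omega) (by simp only [CodeType.N]; omega) (by ext1 i; fin_cases i <;> simp)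
  · exact isFreeOn_relInv_of_eq hχ ![(0, 0), (2, 2)] (d' := 0) (e' := 0)
      (by decide) (by omega) (by simp only [CodeType.N]; omega) (by ext1 i; fin_cases i <;> simp)
  · exact isFreeOn_relInv_of_eq hχ ![(2, 1), (0, 3)] (d' := 1) (e' := 1)
      (by decide) (by omega) (by simp only [CodeType.N]; omega) (by ext1 i; fin_cases i <;> simp)
  · exact isFreeOn_relInv_of_eq hχ ![(2, 0), (0, 2)] (d' := 2) (e' := 2)
      (by decide) (by omega) (by simp only [CodeType.N]; omega) (by ext1 i; fin_cases i <;> simp)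
  · exact isFreeOn_relInv_of_eq hχ ![(0, 1), (2, 3)] (d' := 3) (e' := 3)
      (by decide) (by omega) (by simp only [CodeType.N]; omega) (by ext1 i; fin_cases i <;> simp)
  · exact isFreeOn_relInv_of_eq hχ ![(0, 0)] (d' := 0) (e' := 0)
      (by decide) (by omega) (by simp only [CodeType.N]; omega) (by ext1 i; fin_cases i <;> simp)
  · exact isFreeOn_relInv_of_eq hχ ![(0, 1)] (d' := 1) (e' := 1)
      (by decide) (by omega) (by simp only [CodeType.N]; omega) (by ext1 i; fin_cases i <;> simp)
  · exact isFreeOn_relInv_of_eq hχ ![(0, 0)] (d' := 0) (e' := 0)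
      (by decide) (by omega) (by simp only [CodeType.N]; omega) (by ext1 i; fin_cases i <;> simp)
  · exact isFreeOn_relInv_of_eq hχ ![(1, 1)] (d' := 1) (e' := 2)
      (by decide) (by omega) (by simp only [CodeType.N]; omega) (by ext1 i; fin_cases i <;> simp)
  · exact isFreeOn_relInv_of_eq hχ ![(0, 0), (6, 2), (4, 4), (2, 6)] (d' := 0) (e' := 0)
      (by decide) (by omega) (by simp only [CodeType.N]; omega) (by ext1 i; fin_cases i <;> simp)
  · exact isFreeOn_relInv_of_eq hχ ![(5, 1), (3, 3), (1, 5), (7, 7)] (d' := 1) (e' := 2)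
      (by decide) (by omega) (by simp only [CodeType.N]; omega) (by ext1 i; fin_cases i <;> simp)
  · exact isFreeOn_relInv_of_eq hχ ![(4, 0), (2, 2), (0, 4), (6, 6)] (d' := 2) (e' := 4)
      (by decide) (by omega) (by simp only [CodeType.N]; omega) (by ext1 i; fin_cases i <;> simp)
  · exact isFreeOn_relInv_of_eq hχ ![(1, 1), (7, 3), (5, 5), (3, 7)] (d' := 3) (e' := 6)
      (by decide) (by omega) (by simp only [CodeType.N]; omega) (by ext1 i; fin_cases i <;> simp)
  · exact isFreeOn_relInv_of_eq hχ ![(0, 0), (2, 2)] (d' := 0) (e' := 0)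
      (by decide) (by omega) (by simp only [CodeType.N]; omega) (by ext1 i; fin_cases i <;> simp)
  · exact isFreeOn_relInv_of_eq hχ ![(1, 1), (3, 3)] (d' := 1) (e' := 2)
      (by decide) (by omega) (by simp only [CodeType.N]; omega) (by ext1 i; fin_cases i <;> simp)
  · exact isFreeOn_relInv_of_eq hχ ![(0, 0)] (d' := 0) (e' := 0)
      (by decide) (by omega) (by simp only [CodeType.N]; omega) (by ext1 i; fin_cases i <;> simp)
  · exact isFreeOn_relInv_of_eq hχ ![(1, 1)] (d' := 1) (e' := 2)
      (by decide) (by omega) (by simp only [CodeType.N]; omega) (by ext1 i; fin_cases i <;> simp)
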